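/- Let $d$ be a natural number, $\mathbb T^d=(\mathbb R/2\pi\mathbb Z)^d$, and let $V=V(p,q)\in C^\infty(\mathbb R^d\times\mathbb T^d)$ be a real function that is globally bounded together with all its derivatives, i.e. $\sup_{p\in\mathbb R^d,\,q\in\mathbb T^d}|\partial_p^\alpha\partial_q^\beta V(p,q)|<\infty$ for all multi-indices $\alpha,\beta\in\mathbb N^d$. For $\varepsilon>0$ consider the Hamiltonian $$H(p,q)=\sum_{j=1}^d\frac{p_j^2}{2}+\varepsilon V(p,q),\qquad (p,q)\in\mathbb R^d\times\mathbb T^d ,$$ with Hamilton's equations $\dot p_j=-\partial H/\partial q_j$, $\dot q_j=\partial H/\partial p_j$. Fix $b$ with $0<b<\tfrac12$. Then for every real $M>0$ there exist constants $C_M>0$ and $\varepsilon_M>0$ such that, whenever $0<\varepsilon<\varepsilon_M$, for every initial datum $(p_0,q_0)\in\mathbb R^d\times\mathbb T^d$ Hamilton's equations have a solution $(p(t),q(t))$ defined for all $t\in\mathbb R$ with $(p(0),q(0))=(p_0,q_0)$, and every such solution satisfies $$|p(t)-p(0)|\le C_M\,\varepsilon^{b}\qquad\text{for all } t\in\mathbb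 R \text{ with } |t|\le \frac{C_M}{\varepsilon^{M}} ,$$ where $|\cdot|$ is the Euclidean norm. -/

import Mathlib

open scoped ContDiff

noncomputable section

namespace SmoothNekhoroshev

/-- Momentum space `ℝ^d`, with the Euclidean norm. -/
abbrev Momentum (d : ℕ) : Type := EuclideanSpace ℝ (Fin d)

/-- The torus `𝕋^d = (ℝ / 2πℤ)^d`. -/
abbrev Torus (d : ℕ) : Type := Fin d → AddCircle (2 * Real.pi)

/-- The covering map `ℝ^d → 𝕋^d`. -/
def toTorus {d : ℕ} (x : EuclideanSpace ℝ (Fin d)) : Torus d :=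
  fun j => ((x j : ℝ) : AddCircle (2 * Real.pi))

/-- The lift of a function on `ℝ^d × 𝕋^d` to a function on `ℝ^d × ℝ^d`, periodic in the second
variable. -/
def lift {d : ℕ} (F : Momentum d → Torus d → ℝ) :
    Momentum d × EuclideanSpace ℝ (Fin d) → ℝ :=
  fun z => F z.1 (toTorus z.2)

/-- `F` is of class `C^∞` on `ℝ^d × 𝕋^d`. -/
def IsSmooth {d : ℕ} (F : Momentum d → Torus d → ℝ) : Prop :=
  ContDiff ℝ ∞ (lift F)

/-- `F` is bounded on `ℝ^d × 𝕋^d` together with each of its derivatives: for every order `n` the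
derivatives of order `n` are bounded (`n = 0` being the boundedness of `F` itself). -/
def IsGloballyBounded {d : ℕ} (F : Momentum d → Torus d → ℝ) : Prop :=
  ∀ n : ℕ, ∃ K : ℝ, ∀ z : Momentum d × EuclideanSpace ℝ (Fin d),
    ‖iteratedFDeriv ℝ n (lift F) z‖ ≤ K

/-- The Hamiltonian `H(p, q) = ∑ p_j² / 2 + ε V(p, q)`. -/
def hamiltonian {d : ℕ} (V : Momentum d → Torus d → ℝ) (ε : ℝ) :
    Momentum d → Torus d → ℝ :=
  fun p q => (∑ j, p j ^ 2 / 2) + ε * V p q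

/-- The partial derivative `∂F/∂p_j`, at a point of the covering space. -/
def partialP {d : ℕ} (F : Momentum d → Torus d → ℝ) (j : Fin d)
    (z : Momentum d × EuclideanSpace ℝ (Fin d)) : ℝ :=
  fderiv ℝ (lift F) z (EuclideanSpace.single j 1, 0)

/-- The partial derivative `∂F/∂q_j`, at a point of the covering space. -/
def partialQ {d : ℕ} (F : Momentum d → Torus d → ℝ) (j : Fin d)
    (z : Momentum d × EuclideanSpace ℝ (Fin d)) : ℝ :=
  fderiv ℝ (lift F) z (0, EuclideanSpace.single j 1)

/-- The curve `t ↦ (p t, q t)` in `ℝ^d × 𝕋^d`, defined for all times, solves Hamilton's equations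
`ṗ_j = -∂H/∂q_j`, `q̇_j = ∂H/∂p_j`. The equations are written on a lift `x` of `q` to `ℝ^d`. -/
def IsSolution {d : ℕ} (H : Momentum d → Torus d → ℝ)
    (p : ℝ → Momentum d) (q : ℝ → Torus d) : Prop :=
  ∃ x : ℝ → EuclideanSpace ℝ (Fin d), (∀ t, toTorus (x t) = q t) ∧
    ∀ (t : ℝ) (j : Fin d),
      HasDerivAt (fun s => p s j) (-partialQ H j (p t, x t)) t ∧
      HasDerivAt (fun s => x s j) (partialP H j (p t, x t)) t

end SmoothNekhoroshev

end

open Finset.HasAntidiagonal (antidiagonal mem_antidiagonal)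

noncomputable section

namespace SmoothNekhoroshev

section LieTransform

variable {𝔤 : Type*} [AddCommGroup 𝔤] [Module ℂ 𝔤] (br : 𝔤 →ₗ[ℂ] 𝔤 →ₗ[ℂ] 𝔤)

/-- The formal Lie transform of `f` along the generators `W 0, W 1, …`: the coefficients of the
power series solution `F` of `F' = [F, W]`, `F(0) = f`. -/
def lieTransform (W : ℕ → 𝔤) (f : 𝔤) : ℕ → 𝔤
  | 0 => f
  | n + 1 => ((n : ℂ) + 1)⁻¹ • ∑ i : Fin (n + 1), br (lieTransform W f (n - i)) (W i)

theorem lieTransform_zero (W : ℕ → 𝔤) (f : 𝔤) : lieTransform br W f 0 = f := by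
  simp [lieTransform]

theorem lieTransform_succ (W : ℕ → 𝔤) (f : 𝔤) (n : ℕ) :
    lieTransform br W f (n + 1) = ((n : ℂ) + 1)⁻¹ •
      ∑ x ∈ antidiagonal n, br (lieTransform br W f x.1) (W x.2) := by
  rw [lieTransform, Fin.sum_univ_eq_sum_range (fun i => br (lieTransform br W f (n - i)) (W i)),
    ← Finset.Nat.sum_antidiagonal_eq_sum_range_succ (fun i j => br (lieTransform br W f j) (W i)),
    ← Finset.Nat.sum_antidiagonal_swap]
  simp

theorem smul_lieTransform_succ (W : ℕ → 𝔤) (f : 𝔤) (n : ℕ) :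
    ((n : ℂ) + 1) • lieTransform br W f (n + 1) =
      ∑ x ∈ antidiagonal n, br (lieTransform br W f x.1) (W x.2) := by
  rw [lieTransform_succ, smul_smul, mul_inv_cancel₀ (by exact_mod_cast n.succ_ne_zero), one_smul]

theorem lieTransform_congr {W W' : ℕ → 𝔤} (f : 𝔤) (n : ℕ) (h : ∀ i < n, W i = W' i) :
    lieTransform br W f n = lieTransform br W' f n := by
  induction n using Nat.strong_induction_on with
  | _ n ih =>
    cases n with
    | zero => simp [lieTransform_zero]
    | succ n =>
      rw [lieTransform_succ, lieTransform_succ]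
      congr 1
      refine Finset.sum_congr rfl fun x hx => ?_
      have hx' := mem_antidiagonal.1 hx
      rw [h x.2 (by omega), ih x.1 (by omega) fun i hi => h i (by omega)]

/-- A formal Lie transform is a morphism of Lie algebras. -/
theorem sum_br_lieTransform
    (leib : ∀ f g w, br (br f w) g + br f (br g w) = br (br f g) w)
    (W : ℕ → 𝔤) (f g : 𝔤) (n : ℕ) :
    ∑ x ∈ antidiagonal n, br (lieTransform br W f x.1) (lieTransform br W g x.2) =
      lieTransform br W (br f g) n := by
  induction n using Nat.strong_induction_on with
  | _ n ih =>
  cases n with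
  | zero => simp [lieTransform_zero]
  | succ n =>
    have hn : ((n : ℂ) + 1) ≠ 0 := by exact_mod_cast n.succ_ne_zero
    apply smul_right_injective 𝔤 hn
    simp only
    set F := lieTransform br W f
    set G := lieTransform br W g
    have h1 : ((n : ℂ) + 1) • ∑ x ∈ antidiagonal (n + 1), br (F x.1) (G x.2) =
        ∑ x ∈ antidiagonal (n + 1), br ((x.1 : ℂ) • F x.1) (G x.2) +
        ∑ x ∈ antidiagonal (n + 1), br (F x.1) ((x.2 : ℂ) • G x.2) := by
      rw [← Finset.sum_add_distrib, Finset.smul_sum]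
      refine Finset.sum_congr rfl fun x hx => ?_
      have hx' := mem_antidiagonal.1 hx
      have : (n : ℂ) + 1 = (x.1 : ℂ) + x.2 := by exact_mod_cast hx'.symm
      simp [this, add_smul]
    have h2 : ∑ x ∈ antidiagonal (n + 1), br ((x.1 : ℂ) • F x.1) (G x.2) =
        ∑ x ∈ antidiagonal n, ∑ y ∈ antidiagonal x.1,
          br (br (F y.1) (W y.2)) (G x.2) := by
      rw [Finset.Nat.antidiagonal_succ]
      simp only [Finset.sum_cons, Finset.sum_map, Nat.cast_zero, zero_smul, map_zero,
        LinearMap.zero_apply, zero_add]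
      refine Finset.sum_congr rfl fun x _ => ?_
      have := smul_lieTransform_succ br W f x.1
      change br (((x.1 + 1 : ℕ) : ℂ) • F (x.1 + 1)) (G x.2) = _
      push_cast
      rw [this]
      simp [map_sum, LinearMap.sum_apply, F]
    have h3 : ∑ x ∈ antidiagonal (n + 1), br (F x.1) ((x.2 : ℂ) • G x.2) =
        ∑ x ∈ antidiagonal n, ∑ y ∈ antidiagonal x.2,
          br (F x.1) (br (G y.1) (W y.2)) := by
      rw [Finset.Nat.antidiagonal_succ']
      simp only [Finset.sum_cons, Finset.sum_map, Nat.cast_zero, zero_smul, map_zero, zero_add]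
      refine Finset.sum_congr rfl fun x _ => ?_
      have := smul_lieTransform_succ br W g x.2
      change br (F x.1) (((x.2 + 1 : ℕ) : ℂ) • G (x.2 + 1)) = _
      push_cast
      rw [this]
      simp [map_sum, G]
    have h4 : ((n : ℂ) + 1) • lieTransform br W (br f g) (n + 1) =
        ∑ x ∈ antidiagonal n, ∑ y ∈ antidiagonal x.1,
          br (br (F y.1) (G y.2)) (W x.2) := by
      rw [smul_lieTransform_succ]
      refine Finset.sum_congr rfl fun x hx => ?_
      rw [← ih x.1 (by have := mem_antidiagonal.1 hx; omega)]
      simp [map_sum, LinearMap.sum_apply, F, G]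
    rw [h1, h2, h3, h4]
    have e2 : ∑ x ∈ antidiagonal n, ∑ y ∈ antidiagonal x.1,
          br (br (F y.1) (W y.2)) (G x.2) =
        ∑ x ∈ antidiagonal n, ∑ y ∈ antidiagonal x.1,
          br (br (F y.1) (W x.2)) (G y.2) := by
      rw [Finset.sum_sigma', Finset.sum_sigma']
      refine Finset.sum_bij' (fun x _ => ⟨(x.2.1 + x.1.2, x.2.2), (x.2.1, x.1.2)⟩)
        (fun x _ => ⟨(x.2.1 + x.1.2, x.2.2), (x.2.1, x.1.2)⟩) ?_ ?_ ?_ ?_ ?_ <;>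
      · rintro ⟨⟨a, b⟩, ⟨c, e⟩⟩ h
        simp only [Finset.mem_sigma, mem_antidiagonal] at h ⊢
        try obtain ⟨rfl, rfl⟩ := h
        try first | rfl | omega | exact ⟨by omega, trivial⟩
    have e3 : ∑ x ∈ antidiagonal n, ∑ y ∈ antidiagonal x.2,
          br (F x.1) (br (G y.1) (W y.2)) =
        ∑ x ∈ antidiagonal n, ∑ y ∈ antidiagonal x.1,
          br (F y.1) (br (G y.2) (W x.2)) := by
      rw [Finset.sum_sigma', Finset.sum_sigma']
      refine Finset.sum_bij' (fun x _ => ⟨(x.1.1 + x.2.1, x.2.2), (x.1.1, x.2.1)⟩)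
        (fun x _ => ⟨(x.2.1, x.2.2 + x.1.2), (x.2.2, x.1.2)⟩) ?_ ?_ ?_ ?_ ?_ <;>
      · rintro ⟨⟨a, b⟩, ⟨c, e⟩⟩ h
        simp only [Finset.mem_sigma, mem_antidiagonal] at h ⊢
        try obtain ⟨rfl, rfl⟩ := h
        try first | rfl | omega | exact ⟨by omega, trivial⟩
    rw [e2, e3, ← Finset.sum_add_distrib]
    refine Finset.sum_congr rfl fun x _ => ?_
    rw [← Finset.sum_add_distrib]
    exact Finset.sum_congr rfl fun y _ => leib _ _ _

theorem lieTransform_mem {U S : Submodule ℂ 𝔤} (hS : ∀ f ∈ S, ∀ g ∈ U, br f g ∈ S)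
    {W : ℕ → 𝔤} (hW : ∀ n, W n ∈ U) {f : 𝔤} (hf : f ∈ S) (n : ℕ) :
    lieTransform br W f n ∈ S := by
  induction n using Nat.strong_induction_on with
  | _ n ih =>
  cases n with
  | zero => simpa [lieTransform_zero]
  | succ n =>
    rw [lieTransform_succ]
    refine S.smul_mem _ (S.sum_mem fun x hx => hS _ (ih _ ?_) _ (hW _))
    have := mem_antidiagonal.1 hx
    omega

theorem lieTransform_succ_mem {U : Submodule ℂ 𝔤} (hU : ∀ f ∈ U, ∀ g ∈ U, br f g ∈ U)
    {W : ℕ → 𝔤} (hW : ∀ n, W n ∈ U) {h : 𝔤} (hh : ∀ n, br h (W n) ∈ U) (n : ℕ) :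
    lieTransform br W h (n + 1) ∈ U := by
  induction n using Nat.strong_induction_on with
  | _ n ih =>
  rw [lieTransform_succ]
  refine U.smul_mem _ (U.sum_mem fun x hx => ?_)
  rcases x with ⟨_ | a, b⟩
  · rw [lieTransform_zero]; exact hh b
  · have := mem_antidiagonal.1 hx
    exact hU _ (ih a (by simp only at this; omega)) _ (hW _)

theorem lieTransform_update (W : ℕ → 𝔤) (h w : 𝔤) (n : ℕ) :
    lieTransform br (Function.update W n w) h (n + 1) =
      lieTransform br (Function.update W n 0) h (n + 1) + ((n : ℂ) + 1)⁻¹ • br h w := by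
  rw [lieTransform_succ, lieTransform_succ, ← smul_add]
  congr 1
  rw [← sub_eq_iff_eq_add', ← Finset.sum_sub_distrib]
  have key : ∀ x ∈ antidiagonal n,
      br (lieTransform br (Function.update W n w) h x.1) (Function.update W n w x.2) -
      br (lieTransform br (Function.update W n 0) h x.1) (Function.update W n 0 x.2) =
      if x = (0, n) then br h w else 0 := by
    rintro ⟨a, b⟩ hx
    have hx' := mem_antidiagonal.1 hx
    simp only at hx'
    by_cases hb : b = n
    · obtain rfl : a = 0 := by omega
      subst hb
      simp [lieTransform_zero]
    · rw [if_neg (by simp [hb]), Function.update_of_ne hb, Function.update_of_ne hb,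
        lieTransform_congr br h a (W' := Function.update W n 0), sub_self]
      intro i hi
      rw [Function.update_of_ne (by omega), Function.update_of_ne (by omega)]
  rw [Finset.sum_congr rfl key, Finset.sum_ite_eq', if_pos (by simp)]

/-- Formal normal form of the Hamiltonian `h + s f₁`: it is the Lie transform of a series whose
terms commute with `h` up to elements of `m`. -/
theorem exists_formal_normal_form {U m : Submodule ℂ 𝔤}
    (hU : ∀ f ∈ U, ∀ g ∈ U, br f g ∈ U) {h : 𝔤}
    (solve : ∀ f ∈ U, ∃ χ ∈ U, ∃ z ∈ U, f = br h χ + z ∧ br h z ∈ m)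
    {f₁ w₁ z₁ : 𝔤} (hf₁ : f₁ ∈ U) (hw₁ : w₁ ∈ U) (hz₁ : z₁ ∈ U) (hsol : f₁ = br h w₁ + z₁)
    (hz₁m : br h z₁ ∈ m) (N : ℕ) :
    ∃ W Z : ℕ → 𝔤, W 0 = w₁ ∧ Z 0 = h ∧ (∀ n, W n ∈ U) ∧ (∀ n, br h (W n) ∈ U) ∧
      (∀ n, Z (n + 1) ∈ U) ∧ (∀ n, br h (Z (n + 1)) ∈ m) ∧
      ∀ n ≤ N + 1, ∑ x ∈ antidiagonal n, lieTransform br W (Z x.1) x.2 =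
        if n = 0 then h else if n = 1 then f₁ else 0 := by
  induction N with
  | zero =>
    refine ⟨fun n => if n = 0 then w₁ else 0, fun n => if n = 0 then h else if n = 1 then z₁ else 0,
      by simp, by simp, fun n => ?_, fun n => ?_, fun n => ?_, fun n => ?_, fun n hn => ?_⟩
    · dsimp only
      split_ifs <;> simp [hw₁]
    · dsimp only
      split_ifs
      · rw [show br h w₁ = f₁ - z₁ by rw [hsol]; abel]
        exact U.sub_mem hf₁ hz₁
      · simp
    · by_cases hn : n = 0 <;> simp [hn, hz₁]
    · by_cases hn : n = 0 <;> simp [hn, hz₁m]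
    · interval_cases n
      · simp [lieTransform_zero]
      · simp [Finset.Nat.antidiagonal_succ, lieTransform_zero, lieTransform_succ, hsol]
  | succ N ih =>
    obtain ⟨W, Z, hW0, hZ0, hW, hhW, hZ, hhZ, heq⟩ := ih
    set W₀ := Function.update W (N + 1) 0 with hW₀
    set Z₀ := Function.update Z (N + 2) 0 with hZ₀
    have hW₀U : ∀ n, W₀ n ∈ U := fun n => by
      by_cases hn : n = N + 1
      · subst hn; simp [W₀]
      · rw [hW₀, Function.update_of_ne hn]; exact hW n
    have hhW₀ : ∀ n, br h (W₀ n) ∈ U := fun n => by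
      by_cases hn : n = N + 1
      · subst hn; simp [W₀]
      · rw [hW₀, Function.update_of_ne hn]; exact hhW n
    have hZ₀U : ∀ n, Z₀ (n + 1) ∈ U := fun n => by
      by_cases hn : n + 1 = N + 2
      · rw [hn]; simp [Z₀]
      · rw [hZ₀, Function.update_of_ne hn]; exact hZ n
    have hZ₀0 : Z₀ 0 = h := by rw [hZ₀, Function.update_of_ne (by omega), hZ0]
    set R := ∑ x ∈ antidiagonal (N + 2), lieTransform br W₀ (Z₀ x.1) x.2 with hR
    have hRU : R ∈ U := by
      refine U.sum_mem fun x hx => ?_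
      rcases x with ⟨_ | a, b⟩
      · obtain rfl : b = N + 2 := by simpa using mem_antidiagonal.1 hx
        rw [hZ₀0]
        exact lieTransform_succ_mem br hU hW₀U hhW₀ (N + 1)
      · exact lieTransform_mem br hU hW₀U (hZ₀U a) b
    obtain ⟨χ, hχ, z, hz, hRz, hzm⟩ := solve (-R) (U.neg_mem hRU)
    have hN : ((N + 1 : ℕ) : ℂ) + 1 ≠ 0 := by exact_mod_cast (N + 1).succ_ne_zero
    refine ⟨Function.update W (N + 1) ((((N + 1 : ℕ) : ℂ) + 1) • χ), Function.update Z (N + 2) z,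
      ?_, ?_, fun n => ?_, fun n => ?_, fun n => ?_, fun n => ?_, fun n hn => ?_⟩
    · rw [Function.update_of_ne (by omega), hW0]
    · rw [Function.update_of_ne (by omega), hZ0]
    · by_cases hn : n = N + 1
      · subst hn; rw [Function.update_self]; exact U.smul_mem _ hχ
      · rw [Function.update_of_ne hn]; exact hW n
    · by_cases hn : n = N + 1
      · subst hn
        rw [Function.update_self, map_smul, show br h χ = -R - z by rw [hRz]; abel]
        exact U.smul_mem _ (U.sub_mem (U.neg_mem hRU) hz)
      · rw [Function.update_of_ne hn]; exact hhW n
    · by_cases hn : n + 1 = N + 2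
      · rw [hn, Function.update_self]; exact hz
      · rw [Function.update_of_ne hn]; exact hZ n
    · by_cases hn : n + 1 = N + 2
      · rw [hn, Function.update_self]; exact hzm
      · rw [Function.update_of_ne hn]; exact hhZ n
    · rcases Nat.lt_or_ge n (N + 2) with hlt | hge
      · rw [← heq n (by omega)]
        refine Finset.sum_congr rfl fun x hx => ?_
        have hx' := mem_antidiagonal.1 hx
        rw [Function.update_of_ne (by omega)]
        exact lieTransform_congr br _ _ fun i hi => Function.update_of_ne (by omega) _ _
      · obtain rfl : n = N + 2 := by omega
        rw [if_neg (by omega), if_neg (by omega)]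
        have key : ∀ x ∈ antidiagonal (N + 2),
            lieTransform br (Function.update W (N + 1) ((((N + 1 : ℕ) : ℂ) + 1) • χ))
              (Function.update Z (N + 2) z x.1) x.2 =
            lieTransform br W₀ (Z₀ x.1) x.2 +
              ((if x = (0, N + 2) then br h χ else 0) + if x = (N + 2, 0) then z else 0) := by
          rintro ⟨a, b⟩ hx
          have hx' := mem_antidiagonal.1 hx
          simp only at hx'
          by_cases ha : a = N + 2
          · obtain rfl : b = 0 := by omega
            subst ha
            simp [lieTransform_zero, Z₀]
          · rw [hZ₀, Function.update_of_ne ha, Function.update_of_ne ha,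
              if_neg (c := (a, b) = (N + 2, 0)) (by simp [ha])]
            by_cases ha0 : a = 0
            · obtain rfl : b = N + 2 := by omega
              subst ha0
              rw [if_pos rfl, hZ0, lieTransform_update, map_smul, smul_smul, inv_mul_cancel₀ hN,
                one_smul, add_zero]
            · rw [if_neg (by simp [ha0])]
              simp only [add_zero]
              refine lieTransform_congr br _ _ fun i hi => ?_
              rw [hW₀, Function.update_of_ne (by omega), Function.update_of_ne (by omega)]
        rw [Finset.sum_congr rfl key, Finset.sum_add_distrib, Finset.sum_add_distrib,
          Finset.sum_ite_eq', Finset.sum_ite_eq', if_pos (by simp), if_pos (by simp), ← hR, ← hRz,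
          add_neg_cancel]

/-- Existence of formal integrals `h + s J₁ + s² J₂ + ⋯` of the Hamiltonian `h + s f₁`, up to
elements of the ideal `m`. -/
theorem exists_formal_integral {U m : Submodule ℂ 𝔤}
    (leib : ∀ f g w, br (br f w) g + br f (br g w) = br (br f g) w)
    (hU : ∀ f ∈ U, ∀ g ∈ U, br f g ∈ U) (hm : ∀ f ∈ m, ∀ g ∈ U, br f g ∈ m)
    {h : 𝔤} (hh : br h h = 0)
    (solve : ∀ f ∈ U, ∃ χ ∈ U, ∃ z ∈ U, f = br h χ + z ∧ br h z ∈ m)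
    {f₁ w₁ z₁ : 𝔤} (hf₁ : f₁ ∈ U) (hw₁ : w₁ ∈ U) (hz₁ : z₁ ∈ U) (hsol : f₁ = br h w₁ + z₁)
    (hz₁m : br h z₁ ∈ m) (N : ℕ) :
    ∃ J : ℕ → 𝔤, J 0 = h ∧ J 1 = br h w₁ ∧ (∀ n, J (n + 1) ∈ U) ∧
      ∀ n < N, br (J (n + 1)) h + br (J n) f₁ ∈ m := by
  obtain ⟨W, Z, hW0, hZ0, hW, hhW, hZ, hhZ, heq⟩ :=
    exists_formal_normal_form br hU solve hf₁ hw₁ hz₁ hsol hz₁m N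
  set J := lieTransform br W h with hJ
  refine ⟨J, lieTransform_zero br W h, ?_, lieTransform_succ_mem br hU hW hhW, fun n hn => ?_⟩
  · rw [hJ, lieTransform_succ]
    simp [lieTransform_zero, hW0]
  · have hZm : ∀ c, br h (Z c) ∈ m := fun c => by
      cases c with
      | zero => rw [hZ0, hh]; exact m.zero_mem
      | succ c => exact hhZ c
    have e1 : br (J (n + 1)) h + br (J n) f₁ = ∑ x ∈ antidiagonal (n + 1),
        br (J x.1) (if x.2 = 0 then h else if x.2 = 1 then f₁ else 0) := by
      rw [Finset.Nat.antidiagonal_succ', Finset.sum_cons, Finset.sum_map]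
      congr 1
      cases n with
      | zero => simp
      | succ n =>
        rw [Finset.Nat.antidiagonal_succ', Finset.sum_cons, Finset.sum_map]
        simp
    have e2 : ∑ x ∈ antidiagonal (n + 1),
        br (J x.1) (if x.2 = 0 then h else if x.2 = 1 then f₁ else 0) =
        ∑ x ∈ antidiagonal (n + 1), ∑ y ∈ antidiagonal x.2,
          br (J x.1) (lieTransform br W (Z y.1) y.2) := by
      refine Finset.sum_congr rfl fun x hx => ?_
      have hx' := mem_antidiagonal.1 hx
      rw [← heq x.2 (by omega), map_sum]
    have e3 : ∑ x ∈ antidiagonal (n + 1), ∑ y ∈ antidiagonal x.2,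
          br (J x.1) (lieTransform br W (Z y.1) y.2) =
        ∑ x ∈ antidiagonal (n + 1), ∑ y ∈ antidiagonal x.2,
          br (J y.1) (lieTransform br W (Z x.1) y.2) := by
      rw [Finset.sum_sigma', Finset.sum_sigma']
      refine Finset.sum_bij' (fun x _ => ⟨(x.2.1, x.1.1 + x.2.2), (x.1.1, x.2.2)⟩)
        (fun x _ => ⟨(x.2.1, x.1.1 + x.2.2), (x.1.1, x.2.2)⟩) ?_ ?_ ?_ ?_ ?_ <;>
      · rintro ⟨⟨a, b⟩, ⟨c, e⟩⟩ h
        simp only [Finset.mem_sigma, mem_antidiagonal] at h ⊢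
        try obtain ⟨h1, rfl⟩ := h
        try first | rfl | omega | exact ⟨by omega, trivial⟩
    rw [e1, e2, e3]
    refine m.sum_mem fun x _ => ?_
    rw [sum_br_lieTransform br leib]
    exact lieTransform_mem br hm hW (hZm _) _

end LieTransform

/-- The covering space `ℝ^d × ℝ^d` of the phase space. -/
abbrev Phase (d : ℕ) : Type := Momentum d × EuclideanSpace ℝ (Fin d)

/-- The vector of periods `2πn`. -/
def period {d : ℕ} (n : Fin d → ℤ) : EuclideanSpace ℝ (Fin d) :=
  WithLp.toLp 2 fun j => 2 * Real.pi * n j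

/-- Families, indexed by `I`, of smooth functions on the covering space that are periodic in the
angles. -/
def families (d : ℕ) (I : Type) : Subalgebra ℂ (I → Phase d → ℂ) where
  carrier := {f | ∀ i, ContDiff ℝ ∞ (f i) ∧ ∀ p q n, f i (p, q + period n) = f i (p, q)}
  mul_mem' := fun {f g} hf hg i => ⟨(hf i).1.mul (hg i).1, fun p q n => by
    simp [(hf i).2 p q n, (hg i).2 p q n]⟩
  add_mem' := fun {f g} hf hg i => ⟨(hf i).1.add (hg i).1, fun p q n => by
    simp [(hf i).2 p q n, (hg i).2 p q n]⟩
  algebraMap_mem' := fun c i => ⟨contDiff_const, fun p q n => rfl⟩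

variable {d : ℕ} {I : Type}

theorem families_contDiff (f : families d I) (i : I) : ContDiff ℝ ∞ (f.1 i) := (f.2 i).1

theorem families_differentiable (f : families d I) (i : I) : Differentiable ℝ (f.1 i) :=
  (families_contDiff f i).differentiable (by simp)

theorem families_periodic (f : families d I) (i : I) (p q : EuclideanSpace ℝ (Fin d))
    (n : Fin d → ℤ) : f.1 i (p, q + period n) = f.1 i (p, q) := (f.2 i).2 p q n

/-- The derivative in a fixed direction, as a derivation of the algebra of families. -/
def dirDeriv (v : Phase d) : Derivation ℂ (families d I) (families d I) where
  toFun f := ⟨fun i z => fderiv ℝ (f.1 i) z v, fun i => ⟨by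
    have := (families_contDiff f i).fderiv_right (m := ∞) (by simp)
    exact this.clm_apply contDiff_const, fun p q n => by
      have h : f.1 i = fun z => f.1 i (z + (0, period n)) := by
        ext ⟨p, q⟩
        simp [families_periodic]
      change fderiv ℝ (f.1 i) _ v = fderiv ℝ (f.1 i) _ v
      conv_rhs => rw [h, fderiv_comp_add_right]
      simp⟩⟩
  map_add' f g := by
    ext i z
    have := fderiv_add (families_differentiable f i z) (families_differentiable g i z)
    change fderiv ℝ (f.1 i + g.1 i) z v = _
    rw [this]; rfl
  map_smul' c f := by
    ext i z
    have := fderiv_const_smul (families_differentiable f i z) c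
    change fderiv ℝ (c • f.1 i) z v = _
    rw [this]; rfl
  map_one_eq_zero' := by
    ext i z
    change fderiv ℝ (fun _ => (1 : ℂ)) z v = 0
    simp
  leibniz' f g := by
    ext i z
    have := fderiv_mul (families_differentiable f i z) (families_differentiable g i z)
    change fderiv ℝ (f.1 i * g.1 i) z v = _
    rw [this]; rfl

theorem dirDeriv_apply (v : Phase d) (f : families d I) (i : I) (z : Phase d) :
    (dirDeriv v f).1 i z = fderiv ℝ (f.1 i) z v := rfl

theorem dirDeriv_comm (u v : Phase d) (f : families d I) :
    dirDeriv u (dirDeriv v f) = dirDeriv v (dirDeriv u f) := by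
  ext i z
  simp only [dirDeriv_apply]
  have h2 : Differentiable ℝ (fderiv ℝ (f.1 i)) :=
    ((families_contDiff f i).fderiv_right (m := ∞) (by simp)).differentiable (by simp)
  have key : ∀ a b : Phase d, fderiv ℝ (fun z => fderiv ℝ (f.1 i) z a) z b =
      fderiv ℝ (fderiv ℝ (f.1 i)) z b a := fun a b => by
    rw [fderiv_clm_apply (h2 z) (differentiableAt_const a)]
    simp
  change fderiv ℝ (fun z => fderiv ℝ (f.1 i) z v) z u = fderiv ℝ (fun z => fderiv ℝ (f.1 i) z u) z v
  rw [key, key]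
  exact ((families_contDiff f i).contDiffAt.isSymmSndFDerivAt (by
    simpa using (WithTop.coe_le_coe (α := ℕ∞)).2 (le_top : (2 : ℕ∞) ≤ ⊤))).eq u v

/-- The coordinate directions of the phase space: `Sum.inl j` for `p_j`, `Sum.inr j` for `q_j`. -/
def coordDir : Fin d ⊕ Fin d → Phase d
  | Sum.inl j => (EuclideanSpace.single j 1, 0)
  | Sum.inr j => (0, EuclideanSpace.single j 1)

/-- The partial derivatives of families. -/
def pd (a : Fin d ⊕ Fin d) : Derivation ℂ (families d I) (families d I) := dirDeriv (coordDir a)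

theorem pd_comm (a b : Fin d ⊕ Fin d) (f : families d I) : pd a (pd b f) = pd b (pd a f) :=
  dirDeriv_comm _ _ _

theorem pd_apply (a : Fin d ⊕ Fin d) (f : families d I) (i : I) (z : Phase d) :
    (pd a f).1 i z = fderiv ℝ (f.1 i) z (coordDir a) := rfl

/-- The Poisson bracket of families. -/
def poisson : families d I →ₗ[ℂ] families d I →ₗ[ℂ] families d I :=
  LinearMap.mk₂ ℂ (fun f g => ∑ j, (pd (Sum.inr j) f * pd (Sum.inl j) g -
      pd (Sum.inl j) f * pd (Sum.inr j) g))
    (fun f f' g => by simp only [map_add, add_mul, ← Finset.sum_add_distrib]; congr! 1; ring)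
    (fun c f g => by
      simp only [Derivation.map_smul, smul_mul_assoc, Finset.smul_sum, smul_sub])
    (fun f g g' => by simp only [map_add, mul_add, ← Finset.sum_add_distrib]; congr! 1; ring)
    (fun c f g => by
      simp only [Derivation.map_smul, mul_smul_comm, Finset.smul_sum, smul_sub])

theorem poisson_def (f g : families d I) : poisson f g =
    ∑ j, (pd (Sum.inr j) f * pd (Sum.inl j) g - pd (Sum.inl j) f * pd (Sum.inr j) g) := rfl

theorem poisson_self (f : families d I) : poisson f f = 0 := by
  rw [poisson_def]
  exact Finset.sum_eq_zero fun j _ => by ring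

theorem sum_sum_eq_zero_of_antisymm {A : Type*} [AddCommGroup A] [Module ℂ A]
    {F : Fin d → Fin d → A} (h : ∀ j k, F j k + F k j = 0) : ∑ j, ∑ k, F j k = 0 := by
  have h2 : (2 : ℂ) • ∑ j, ∑ k, F j k = 0 := by
    rw [two_smul]
    nth_rewrite 2 [Finset.sum_comm]
    simp only [← Finset.sum_add_distrib, h, Finset.sum_const_zero]
  exact (smul_eq_zero.1 h2).resolve_left two_ne_zero

/-- The Jacobi identity. -/
theorem poisson_leibniz (f g w : families d I) :
    poisson (poisson f w) g + poisson f (poisson g w) = poisson (poisson f g) w := by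
  rw [poisson_def (poisson f w) g, poisson_def f (poisson g w), poisson_def (poisson f g) w]
  simp only [poisson_def, map_sum, map_sub, Derivation.leibniz, smul_eq_mul, Finset.sum_mul,
    Finset.mul_sum, ← Finset.sum_sub_distrib]
  rw [← sub_eq_zero, ← Finset.sum_add_distrib, ← Finset.sum_sub_distrib]
  simp only [← Finset.sum_add_distrib, ← Finset.sum_sub_distrib]
  refine sum_sum_eq_zero_of_antisymm fun j k => ?_
  simp only [pd_comm (Sum.inr j) (Sum.inr k), pd_comm (Sum.inr j) (Sum.inl k),
    pd_comm (Sum.inl j) (Sum.inl k), pd_comm (Sum.inl j) (Sum.inr k)]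
  ring

/-- Uniform boundedness of a family over the momenta in the unit ball. -/
def UnifBdd (f : families d I) : Prop :=
  ∃ C : ℝ, ∀ i (z : Phase d), ‖z.1‖ ≤ 1 → ‖f.1 i z‖ ≤ C

theorem UnifBdd.add {f g : families d I} (hf : UnifBdd f) (hg : UnifBdd g) : UnifBdd (f + g) := by
  obtain ⟨C, hC⟩ := hf
  obtain ⟨D, hD⟩ := hg
  exact ⟨C + D, fun i z hz => (norm_add_le _ _).trans (add_le_add (hC i z hz) (hD i z hz))⟩

theorem UnifBdd.mul {f g : families d I} (hf : UnifBdd f) (hg : UnifBdd g) : UnifBdd (f * g) := by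
  obtain ⟨C, hC⟩ := hf
  obtain ⟨D, hD⟩ := hg
  refine ⟨C * D, fun i z hz => ?_⟩
  change ‖f.1 i z * g.1 i z‖ ≤ _
  rw [norm_mul]
  exact mul_le_mul (hC i z hz) (hD i z hz) (norm_nonneg _) ((norm_nonneg _).trans (hC i z hz))

theorem UnifBdd.smul {f : families d I} (c : ℂ) (hf : UnifBdd f) : UnifBdd (c • f) := by
  obtain ⟨C, hC⟩ := hf
  refine ⟨‖c‖ * C, fun i z hz => ?_⟩
  change ‖c • f.1 i z‖ ≤ _
  rw [norm_smul]
  exact mul_le_mul_of_nonneg_left (hC i z hz) (norm_nonneg _)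

theorem unifBdd_zero : UnifBdd (0 : families d I) := ⟨0, fun i z _ => by simp⟩

/-- Iterated partial derivatives. -/
def iterPd (l : List (Fin d ⊕ Fin d)) : families d I →ₗ[ℂ] families d I :=
  l.foldr (fun a L => L ∘ₗ (pd a).toLinearMap) LinearMap.id

@[simp] theorem iterPd_nil (f : families d I) : iterPd [] f = f := rfl

@[simp] theorem iterPd_cons (a : Fin d ⊕ Fin d) (l : List (Fin d ⊕ Fin d)) (f : families d I) :
    iterPd (a :: l) f = iterPd l (pd a f) := rfl

/-- Families all of whose derivatives are uniformly bounded over the momenta in the unit ball. -/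
def unifSmooth (d : ℕ) (I : Type) : Submodule ℂ (families d I) where
  carrier := {f | ∀ l, UnifBdd (iterPd l f)}
  add_mem' := fun hf hg l => by rw [map_add]; exact (hf l).add (hg l)
  zero_mem' := fun l => by rw [map_zero]; exact unifBdd_zero
  smul_mem' := fun c f hf l => by rw [map_smul]; exact (hf l).smul c

theorem mem_unifSmooth {f : families d I} : f ∈ unifSmooth d I ↔ ∀ l, UnifBdd (iterPd l f) :=
  Iff.rfl

theorem unifSmooth.unifBdd {f : families d I} (hf : f ∈ unifSmooth d I) : UnifBdd f := hf []

theorem pd_mem {f : families d I} (hf : f ∈ unifSmooth d I) (a : Fin d ⊕ Fin d) :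
    pd a f ∈ unifSmooth d I := fun l => hf (a :: l)

theorem mem_unifSmooth_of {f : families d I} (h0 : UnifBdd f)
    (h : ∀ a, pd a f ∈ unifSmooth d I) : f ∈ unifSmooth d I
  | [] => h0
  | a :: l => h a l

theorem mul_mem_unifSmooth {f g : families d I} (hf : f ∈ unifSmooth d I)
    (hg : g ∈ unifSmooth d I) : f * g ∈ unifSmooth d I := by
  intro l
  induction l generalizing f g with
  | nil => exact (unifSmooth.unifBdd hf).mul (unifSmooth.unifBdd hg)
  | cons a l ih =>
    rw [iterPd_cons, Derivation.leibniz, map_add, smul_eq_mul, smul_eq_mul]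
    exact (ih hf (pd_mem hg a)).add (ih hg (pd_mem hf a))

theorem poisson_mem_unifSmooth {f g : families d I} (hf : f ∈ unifSmooth d I)
    (hg : g ∈ unifSmooth d I) : poisson f g ∈ unifSmooth d I := by
  rw [poisson_def]
  exact Submodule.sum_mem _ fun j _ => Submodule.sub_mem _
    (mul_mem_unifSmooth (pd_mem hf _) (pd_mem hg _)) (mul_mem_unifSmooth (pd_mem hf _) (pd_mem hg _))

/-- The family of constants given by a function of the index. -/
def cst (c : I → ℂ) : families d I :=
  ⟨fun i _ => c i, fun _ => ⟨contDiff_const, fun _ _ _ => rfl⟩⟩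

@[simp] theorem cst_apply (c : I → ℂ) (i : I) (z : Phase d) : (cst c : families d I).1 i z = c i :=
  rfl

@[simp] theorem dirDeriv_cst (v : Phase d) (c : I → ℂ) : dirDeriv v (cst c : families d I) = 0 := by
  ext i z
  change fderiv ℝ (fun _ => c i) z v = 0
  simp

@[simp] theorem pd_cst (a : Fin d ⊕ Fin d) (c : I → ℂ) : pd a (cst c : families d I) = 0 :=
  dirDeriv_cst _ _

theorem pd_cst_mul (a : Fin d ⊕ Fin d) (c : I → ℂ) (f : families d I) :
    pd a (cst c * f) = cst c * pd a f := by
  rw [Derivation.leibniz, pd_cst]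
  simp

theorem iterPd_cst_mul (l : List (Fin d ⊕ Fin d)) (c : I → ℂ) (f : families d I) :
    iterPd l (cst c * f) = cst c * iterPd l f := by
  induction l generalizing f with
  | nil => rfl
  | cons a l ih => rw [iterPd_cons, iterPd_cons, pd_cst_mul, ih]

theorem poisson_cst_mul_right (c : I → ℂ) (f g : families d I) :
    poisson f (cst c * g) = cst c * poisson f g := by
  simp only [poisson_def, pd_cst_mul, Finset.mul_sum]
  exact Finset.sum_congr rfl fun j _ => by ring

theorem poisson_cst_mul_left (c : I → ℂ) (f g : families d I) :
    poisson (cst c * f) g = cst c * poisson f g := by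
  simp only [poisson_def, pd_cst_mul, Finset.mul_sum]
  exact Finset.sum_congr rfl fun j _ => by ring

theorem cst_mem_unifSmooth {c : I → ℂ} {C : ℝ} (hc : ∀ i, ‖c i‖ ≤ C) :
    (cst c : families d I) ∈ unifSmooth d I :=
  mem_unifSmooth_of ⟨C, fun _ _ _ => hc _⟩ fun a => by rw [pd_cst]; exact Submodule.zero_mem _

/-- Families that are smaller than every power of `1 / X`, with all their derivatives. -/
def negligible (d : ℕ) {I : Type} (X : I → ℝ) : Submodule ℂ (families d I) where
  carrier := {f | ∀ n : ℕ, cst (fun i => (X i : ℂ) ^ n) * f ∈ unifSmooth d I}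
  add_mem' := fun hf hg n => by rw [mul_add]; exact Submodule.add_mem _ (hf n) (hg n)
  zero_mem' := fun n => by rw [mul_zero]; exact Submodule.zero_mem _
  smul_mem' := fun c f hf n => by rw [mul_smul_comm]; exact Submodule.smul_mem _ _ (hf n)

theorem poisson_mem_negligible {X : I → ℝ} {f g : families d I} (hf : f ∈ negligible d X)
    (hg : g ∈ unifSmooth d I) : poisson f g ∈ negligible d X := fun n => by
  rw [← poisson_cst_mul_left]
  exact poisson_mem_unifSmooth (hf n) hg

/-- The coordinate function `p_j`. -/
def mom (j : Fin d) : families d I :=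
  ⟨fun _ z => ((z.1 j : ℝ) : ℂ), fun _ => ⟨Complex.ofRealCLM.contDiff.comp (by fun_prop),
    fun _ _ _ => rfl⟩⟩

theorem dirDeriv_mom (v : Phase d) (j : Fin d) :
    dirDeriv v (mom j : families d I) = cst fun _ => ((v.1 j : ℝ) : ℂ) := by
  ext i z
  let L : Phase d →L[ℝ] ℂ := Complex.ofRealCLM ∘L (EuclideanSpace.proj j) ∘L
    (ContinuousLinearMap.fst ℝ (Momentum d) (EuclideanSpace ℝ (Fin d)))
  change fderiv ℝ L z v = L v
  rw [ContinuousLinearMap.fderiv]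

theorem pd_inl_mom (j k : Fin d) :
    pd (Sum.inl k) (mom j : families d I) = if j = k then 1 else 0 := by
  rw [pd, dirDeriv_mom]
  ext i z
  by_cases h : j = k
  · simp [coordDir, h]
  · simp [coordDir, h]

theorem pd_inr_mom (j k : Fin d) : pd (Sum.inr k) (mom j : families d I) = 0 := by
  rw [pd, dirDeriv_mom]
  ext i z
  simp [coordDir]

theorem mom_mem_unifSmooth (j : Fin d) : (mom j : families d I) ∈ unifSmooth d I := by
  refine mem_unifSmooth_of ⟨1, fun i z hz => ?_⟩ fun a => ?_
  · change ‖((z.1 j : ℝ) : ℂ)‖ ≤ 1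
    rw [Complex.norm_real]
    exact (PiLp.norm_apply_le z.1 j).trans hz
  · rw [pd, dirDeriv_mom]
    exact cst_mem_unifSmooth (C := ‖(((coordDir a).1 j : ℝ) : ℂ)‖) fun _ => le_rfl

/-- The kinetic energy `|p|² / 2`. -/
def kinetic : families d I := (2⁻¹ : ℂ) • ∑ j, mom j * mom j

theorem kinetic_mem_unifSmooth : (kinetic : families d I) ∈ unifSmooth d I :=
  Submodule.smul_mem _ _ (Submodule.sum_mem _ fun j _ =>
    mul_mem_unifSmooth (mom_mem_unifSmooth j) (mom_mem_unifSmooth j))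

theorem pd_inl_kinetic (k : Fin d) : pd (Sum.inl k) (kinetic : families d I) = mom k := by
  simp only [kinetic, Derivation.map_smul, map_sum, Derivation.leibniz, pd_inl_mom, smul_eq_mul, mul_ite,
    mul_one, mul_zero, Finset.sum_add_distrib, Finset.sum_ite_eq', Finset.mem_univ, if_true]
  rw [← two_smul ℂ, smul_smul]
  norm_num

theorem pd_inr_kinetic (k : Fin d) : pd (Sum.inr k) (kinetic : families d I) = 0 := by
  simp [kinetic, map_sum, Derivation.leibniz, pd_inr_mom]

/-- The linear function `∑ j, v_j p_j`. -/
def linHam (v : I → Momentum d) : families d I := ∑ j, cst (fun i => ((v i j : ℝ) : ℂ)) * mom j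

theorem pd_inl_linHam (v : I → Momentum d) (k : Fin d) :
    pd (Sum.inl k) (linHam v) = cst (fun i => ((v i k : ℝ) : ℂ)) := by
  simp [linHam, map_sum, pd_inl_mom]

theorem pd_inr_linHam (v : I → Momentum d) (k : Fin d) : pd (Sum.inr k) (linHam v) = 0 := by
  simp [linHam, map_sum, pd_inr_mom]

theorem poisson_linHam (v : I → Momentum d) (f : families d I) :
    poisson (linHam v) f = -∑ j, cst (fun i => ((v i j : ℝ) : ℂ)) * pd (Sum.inr j) f := by
  simp [poisson_def, pd_inl_linHam, pd_inr_linHam]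

theorem poisson_linHam_kinetic (v : I → Momentum d) : poisson (linHam v) kinetic = 0 := by
  simp [poisson_linHam, pd_inr_kinetic]

open MeasureTheory

section Averages

variable {Θ E' F : Type} [MeasurableSpace Θ] (μ : Measure Θ) [IsFiniteMeasure μ]
  [NormedAddCommGroup E'] [ProperSpace E'] [NormedAddCommGroup F] [NormedSpace ℂ F]
  {c : Θ → ℂ} {s : Θ → E'} {R : ℝ}

theorem integrable_smul_translate (hc : StronglyMeasurable c) (hc1 : ∀ θ, ‖c θ‖ ≤ 1)
    (hs : StronglyMeasurable s) (hsR : ∀ θ, ‖s θ‖ ≤ R) {G : E' → F} (hG : Continuous G) (z : E') :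
    Integrable (fun θ => c θ • G (z + s θ)) μ := by
  obtain ⟨C, hC⟩ := ((isCompact_closedBall (0 : E') (‖z‖ + R)).image hG).isBounded.exists_norm_le
  refine Integrable.of_bound (C := C) ?_ (Filter.Eventually.of_forall fun θ => ?_)
  · exact (hc.smul (hG.comp_stronglyMeasurable
      (stronglyMeasurable_const.add hs))).aestronglyMeasurable
  · have h1 : ‖G (z + s θ)‖ ≤ C := by
      refine hC _ ⟨_, ?_, rfl⟩
      rw [mem_closedBall_zero_iff]
      exact (norm_add_le _ _).trans (by linarith [hsR θ])
    rw [norm_smul]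
    nlinarith [hc1 θ, norm_nonneg (c θ), norm_nonneg (G (z + s θ))]

variable [NormedSpace ℝ E'] [NormedSpace ℝ F] [SMulCommClass ℝ ℂ F]

theorem hasFDerivAt_integral_translate (hc : StronglyMeasurable c) (hc1 : ∀ θ, ‖c θ‖ ≤ 1)
    (hs : StronglyMeasurable s) (hsR : ∀ θ, ‖s θ‖ ≤ R) {G : E' → F} (hG : ContDiff ℝ 1 G)
    (z : E') : HasFDerivAt (fun z => ∫ θ, c θ • G (z + s θ) ∂μ)
      (∫ θ, c θ • fderiv ℝ G (z + s θ) ∂μ) z := by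
  have hG' : Continuous (fderiv ℝ G) := hG.continuous_fderiv (by simp)
  obtain ⟨C, hC⟩ :=
    ((isCompact_closedBall (0 : E') (‖z‖ + 1 + R)).image hG').isBounded.exists_norm_le
  refine hasFDerivAt_integral_of_dominated_of_fderiv_le (𝕜 := ℝ) (bound := fun _ => C)
    (F := fun z θ => c θ • G (z + s θ)) (F' := fun z θ => c θ • fderiv ℝ G (z + s θ))
    (Metric.ball_mem_nhds z one_pos) ?_ ?_ ?_ ?_ (integrable_const (μ := μ) C) ?_
  · exact Filter.Eventually.of_forall fun x =>
      (integrable_smul_translate μ hc hc1 hs hsR hG.continuous x).aestronglyMeasurable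
  · exact integrable_smul_translate μ hc hc1 hs hsR hG.continuous z
  · exact (integrable_smul_translate μ hc hc1 hs hsR hG' z).aestronglyMeasurable
  · refine Filter.Eventually.of_forall fun θ x hx => ?_
    have h1 : ‖fderiv ℝ G (x + s θ)‖ ≤ C := by
      refine hC _ ⟨_, ?_, rfl⟩
      rw [mem_closedBall_zero_iff]
      have h2 : ‖x‖ ≤ ‖z‖ + 1 := by
        have := norm_sub_norm_le x z
        rw [Metric.mem_ball, dist_eq_norm] at hx
        linarith
      exact (norm_add_le _ _).trans (by linarith [hsR θ])
    rw [norm_smul]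
    nlinarith [hc1 θ, norm_nonneg (c θ), norm_nonneg (fderiv ℝ G (x + s θ))]
  · refine Filter.Eventually.of_forall fun θ x _ => ?_
    have h1 := (hG.differentiable (by simp) (x + s θ)).hasFDerivAt
    exact ((hasFDerivAt_comp_add_right (s θ)).2 h1).const_smul (c θ)

theorem contDiff_integral_translate (hc : StronglyMeasurable c) (hc1 : ∀ θ, ‖c θ‖ ≤ 1)
    (hs : StronglyMeasurable s) (hsR : ∀ θ, ‖s θ‖ ≤ R) (n : ℕ) {G : E' → F} (hG : ContDiff ℝ ∞ G) :
    ContDiff ℝ n (fun z => ∫ θ, c θ • G (z + s θ) ∂μ) := by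
  induction n generalizing F with
  | zero =>
    have hG1 : ContDiff ℝ 1 G := hG.of_le (by exact_mod_cast le_top)
    refine contDiff_zero.2 (Differentiable.continuous (𝕜 := ℝ) fun z =>
      (hasFDerivAt_integral_translate μ hc hc1 hs hsR hG1 z).differentiableAt)
  | succ n ih =>
    have hG1 : ContDiff ℝ 1 G := hG.of_le (by exact_mod_cast le_top)
    push_cast
    refine (contDiff_succ_iff_fderiv (n := n)).2 ⟨fun z =>
      (hasFDerivAt_integral_translate μ hc hc1 hs hsR hG1 z).differentiableAt, by simp, ?_⟩
    have e : fderiv ℝ (fun z => ∫ θ, c θ • G (z + s θ) ∂μ) =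
        fun z => ∫ θ, c θ • fderiv ℝ G (z + s θ) ∂μ := by
      ext1 z
      exact (hasFDerivAt_integral_translate μ hc hc1 hs hsR hG1 z).fderiv
    rw [e]
    have hG' : ContDiff ℝ ∞ (fderiv ℝ G) := hG.fderiv_right (m := ∞) (by simp)
    exact ih hG'

end Averages

/-- The normalized Haar measure of the torus. -/
def torusMeasure (d : ℕ) : Measure (UnitAddTorus (Fin d)) :=
  Measure.pi fun _ => AddCircle.haarAddCircle

instance : IsProbabilityMeasure (torusMeasure d) :=
  inferInstanceAs (IsProbabilityMeasure (Measure.pi fun _ : Fin d => AddCircle.haarAddCircle))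

instance : (torusMeasure d).IsAddHaarMeasure :=
  inferInstanceAs (Measure.IsAddHaarMeasure (Measure.pi fun _ : Fin d => AddCircle.haarAddCircle))

/-- A bounded measurable section of the covering of the torus. -/
def torusSection (θ : UnitAddTorus (Fin d)) : EuclideanSpace ℝ (Fin d) :=
  WithLp.toLp 2 fun j => 2 * Real.pi * (AddCircle.equivIoc (1 : ℝ) 0 (θ j) : ℝ)

theorem measurable_torusSection :
    Measurable (torusSection : UnitAddTorus (Fin d) → EuclideanSpace ℝ (Fin d)) := by
  refine (WithLp.measurable_toLp 2 _).comp (measurable_pi_lambda _ fun j => ?_)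
  have h1 : Measurable fun x : UnitAddCircle => (AddCircle.equivIoc (1 : ℝ) 0 x : ℝ) :=
    measurable_subtype_coe.comp (AddCircle.measurableEquivIoc (1 : ℝ) 0).measurable
  exact (h1.comp (measurable_pi_apply j)).const_mul _

theorem exists_norm_torusSection_le : ∃ R : ℝ, ∀ θ : UnitAddTorus (Fin d), ‖torusSection θ‖ ≤ R := by
  obtain ⟨R, hR⟩ := (isCompact_univ_pi fun _ : Fin d =>
    isCompact_Icc (a := (0 : ℝ)) (b := 2 * Real.pi)).image (PiLp.continuous_toLp 2 fun _ => ℝ)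
      |>.isBounded.exists_norm_le
  refine ⟨R, fun θ => hR _ ⟨_, fun j _ => ?_, rfl⟩⟩
  have h := (AddCircle.equivIoc (1 : ℝ) 0 (θ j)).2
  have hp := Real.pi_pos
  constructor
  · exact mul_nonneg (by positivity) h.1.le
  · have := h.2
    nlinarith

/-- The projection of the line onto the unit torus, in units of the period `2π`. -/
def toUnitTorus (q : EuclideanSpace ℝ (Fin d)) : UnitAddTorus (Fin d) :=
  fun j => ((q j / (2 * Real.pi) : ℝ) : UnitAddCircle)

theorem toUnitTorus_add (q r : EuclideanSpace ℝ (Fin d)) :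
    toUnitTorus (q + r) = toUnitTorus q + toUnitTorus r := by
  ext j
  simp [toUnitTorus, add_div]

theorem toUnitTorus_torusSection (θ : UnitAddTorus (Fin d)) : toUnitTorus (torusSection θ) = θ := by
  ext j
  have hp := Real.two_pi_pos.ne'
  simp only [toUnitTorus, torusSection]
  rw [mul_div_cancel_left₀ _ hp]
  exact (AddCircle.equivIoc (1 : ℝ) 0).symm_apply_apply (θ j)

theorem exists_period_of_toUnitTorus_eq {q r : EuclideanSpace ℝ (Fin d)}
    (h : toUnitTorus q = toUnitTorus r) : ∃ n, r = q + period n := by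
  have hp := Real.two_pi_pos.ne'
  have : ∀ j, ∃ n : ℤ, r j = q j + 2 * Real.pi * n := fun j => by
    have hj := congrFun h j
    simp only [toUnitTorus] at hj
    obtain ⟨n, hn⟩ := (AddCircle.coe_eq_zero_iff (1 : ℝ) (x := r j / (2 * Real.pi) -
      q j / (2 * Real.pi))).1 (by rw [AddCircle.coe_sub, hj, sub_self])
    refine ⟨n, ?_⟩
    rw [zsmul_eq_mul, mul_one, ← sub_div, eq_div_iff hp] at hn
    linarith
  choose n hn using this
  exact ⟨n, by ext j; simp [period, hn]⟩

theorem apply_add_torusSection (f : families d I) (i : I) (p q r : EuclideanSpace ℝ (Fin d)) :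
    f.1 i (p, q + torusSection (toUnitTorus r)) = f.1 i (p, q + r) := by
  obtain ⟨n, hn⟩ := exists_period_of_toUnitTorus_eq (q := r) (r := torusSection (toUnitTorus r))
    (by rw [toUnitTorus_torusSection])
  rw [hn, ← add_assoc, families_periodic]

theorem continuous_apply_torusSection (f : families d I) (i : I) (p q : EuclideanSpace ℝ (Fin d)) :
    Continuous fun θ : UnitAddTorus (Fin d) => f.1 i (p, q + torusSection θ) := by
  have hq : IsOpenQuotientMap (Pi.map fun _ : Fin d => ((↑) : ℝ → UnitAddCircle)) :=
    IsOpenQuotientMap.piMap fun _ => QuotientAddGroup.isOpenQuotientMap_mk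
  refine hq.isQuotientMap.continuous_iff.2 ?_
  have e : (fun θ : UnitAddTorus (Fin d) => f.1 i (p, q + torusSection θ)) ∘
      (Pi.map fun _ : Fin d => ((↑) : ℝ → UnitAddCircle)) =
      fun x => f.1 i (p, q + (2 * Real.pi) • WithLp.toLp 2 x) := by
    ext x
    have : (Pi.map fun _ : Fin d => ((↑) : ℝ → UnitAddCircle)) x =
        toUnitTorus ((2 * Real.pi) • WithLp.toLp 2 x) := by
      ext j
      have hp := Real.two_pi_pos.ne'
      simp only [toUnitTorus, Pi.map_apply, PiLp.smul_apply, smul_eq_mul]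
      rw [mul_div_cancel_left₀ _ hp]
    rw [Function.comp_apply, this, apply_add_torusSection]
  rw [e]
  have h2 : Continuous fun x : Fin d → ℝ => (WithLp.toLp 2 x : EuclideanSpace ℝ (Fin d)) :=
    PiLp.continuous_toLp 2 fun _ => ℝ
  have h3 : Continuous fun x : Fin d → ℝ =>
      ((p, q + (2 * Real.pi) • WithLp.toLp 2 x) : Phase d) := by fun_prop
  exact (families_contDiff f i).continuous.comp h3

theorem mFourier_add_apply (k : Fin d → ℤ) (θ φ : UnitAddTorus (Fin d)) :
    UnitAddTorus.mFourier k (θ + φ) = UnitAddTorus.mFourier k θ * UnitAddTorus.mFourier k φ := by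
  simp [UnitAddTorus.mFourier, ← Finset.prod_mul_distrib, fourier_apply, AddCircle.toCircle_add]

theorem norm_mFourier_apply (k : Fin d → ℤ) (θ : UnitAddTorus (Fin d)) :
    ‖UnitAddTorus.mFourier k θ‖ = 1 := by
  rw [UnitAddTorus.mFourier, ContinuousMap.coe_mk, norm_prod]
  exact Finset.prod_eq_one fun b _ => Circle.norm_coe _

/-- The phase `∑ j, k_j q_j`. -/
def dot (k : Fin d → ℤ) (q : EuclideanSpace ℝ (Fin d)) : ℝ := ∑ j, k j * q j

theorem mFourier_toUnitTorus (k : Fin d → ℤ) (q : EuclideanSpace ℝ (Fin d)) :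
    UnitAddTorus.mFourier k (toUnitTorus q) = Complex.exp (Complex.I * dot k q) := by
  have hp : (Real.pi : ℂ) ≠ 0 := by exact_mod_cast Real.pi_ne_zero
  simp only [UnitAddTorus.mFourier, ContinuousMap.coe_mk, toUnitTorus, fourier_coe_apply, dot]
  rw [← Complex.exp_sum]
  congr 1
  push_cast
  rw [Finset.mul_sum]
  refine Finset.sum_congr rfl fun j _ => ?_
  field_simp

theorem stronglyMeasurable_torusSection : StronglyMeasurable
    (fun θ : UnitAddTorus (Fin d) => ((0, torusSection θ) : Phase d)) :=
  stronglyMeasurable_const.prodMk measurable_torusSection.stronglyMeasurable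

theorem exists_norm_zero_torusSection_le :
    ∃ R : ℝ, ∀ θ : UnitAddTorus (Fin d), ‖((0, torusSection θ) : Phase d)‖ ≤ R := by
  obtain ⟨R, hR⟩ := exists_norm_torusSection_le (d := d)
  exact ⟨R, fun θ => by simpa [Prod.norm_def] using hR θ⟩

/-- The Fourier mode `f_k(p) exp(i k·q)` of a family. -/
def mode (k : Fin d → ℤ) (f : families d I) : families d I :=
  ⟨fun i z => ∫ θ, UnitAddTorus.mFourier (-k) θ • f.1 i (z + (0, torusSection θ)) ∂torusMeasure d,
    fun i => ⟨by
    obtain ⟨R, hR⟩ := exists_norm_zero_torusSection_le (d := d)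
    exact contDiff_infty.2 fun n => contDiff_integral_translate (torusMeasure d)
      (UnitAddTorus.mFourier (-k)).continuous.stronglyMeasurable
      (fun θ => (norm_mFourier_apply _ θ).le) stronglyMeasurable_torusSection hR n
      (families_contDiff f i), fun p q n => by
    dsimp only
    congr 1
    ext θ
    rw [Prod.mk_add_mk, Prod.mk_add_mk, add_right_comm, families_periodic]⟩⟩

theorem mode_apply (k : Fin d → ℤ) (f : families d I) (i : I) (z : Phase d) : (mode k f).1 i z =
    ∫ θ, UnitAddTorus.mFourier (-k) θ • f.1 i (z + (0, torusSection θ)) ∂torusMeasure d := rfl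

theorem dirDeriv_mode (v : Phase d) (k : Fin d → ℤ) (f : families d I) :
    dirDeriv v (mode k f) = mode k (dirDeriv v f) := by
  ext i z
  obtain ⟨R, hR⟩ := exists_norm_zero_torusSection_le (d := d)
  have hG : ContDiff ℝ 1 (f.1 i) := (families_contDiff f i).of_le (by exact_mod_cast le_top)
  have hc := (UnitAddTorus.mFourier (-k)).continuous.stronglyMeasurable
  have hc1 := fun θ => (norm_mFourier_apply (-k) θ).le
  have h := hasFDerivAt_integral_translate (torusMeasure d) hc hc1 stronglyMeasurable_torusSection hR hG z
  have hi := integrable_smul_translate (torusMeasure d) hc hc1 stronglyMeasurable_torusSection hR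
    (hG.continuous_fderiv (by simp)) z
  rw [dirDeriv_apply, mode_apply]
  change fderiv ℝ (fun z => ∫ θ, UnitAddTorus.mFourier (-k) θ •
    f.1 i (z + (0, torusSection θ)) ∂torusMeasure d) z v = _
  rw [h.fderiv, ContinuousLinearMap.integral_apply hi]
  rfl

theorem pd_mode (a : Fin d ⊕ Fin d) (k : Fin d → ℤ) (f : families d I) :
    pd a (mode k f) = mode k (pd a f) := dirDeriv_mode _ _ _

theorem mode_translate (k : Fin d → ℤ) (f : families d I) (i : I)
    (p q r : EuclideanSpace ℝ (Fin d)) : (mode k f).1 i (p, q + r) =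
      Complex.exp (Complex.I * dot k r) * (mode k f).1 i (p, q) := by
  have h1 : ∀ θ : UnitAddTorus (Fin d), f.1 i ((p, q + r) + (0, torusSection θ)) =
      f.1 i ((p, q) + (0, torusSection (θ + toUnitTorus r))) := fun θ => by
    rw [Prod.mk_add_mk, Prod.mk_add_mk, add_zero, ← apply_add_torusSection f i p q
      (torusSection (θ + toUnitTorus r)), toUnitTorus_torusSection]
    nth_rewrite 2 [← toUnitTorus_torusSection θ]
    rw [← toUnitTorus_add, apply_add_torusSection, add_assoc, add_comm r]
  have h2 : ∀ θ : UnitAddTorus (Fin d), UnitAddTorus.mFourier (-k) θ =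
      UnitAddTorus.mFourier k (toUnitTorus r) *
        UnitAddTorus.mFourier (-k) (θ + toUnitTorus r) := fun θ => by
    rw [mFourier_add_apply, mul_left_comm, ← UnitAddTorus.mFourier_add]
    simp [UnitAddTorus.mFourier_zero]
  have h3 : (fun θ : UnitAddTorus (Fin d) => UnitAddTorus.mFourier (-k) θ •
        f.1 i ((p, q + r) + (0, torusSection θ))) = fun θ =>
      UnitAddTorus.mFourier k (toUnitTorus r) • (UnitAddTorus.mFourier (-k) (θ + toUnitTorus r) •
        f.1 i ((p, q) + (0, torusSection (θ + toUnitTorus r)))) := by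
    ext θ
    rw [h1, h2, mul_smul]
  rw [mode_apply, mode_apply, h3, integral_smul, smul_eq_mul, ← mFourier_toUnitTorus]
  congr 1
  exact integral_add_right_eq_self (fun θ => UnitAddTorus.mFourier (-k) θ •
    f.1 i ((p, q) + (0, torusSection θ))) (toUnitTorus r)

theorem dot_single (k : Fin d → ℤ) (j : Fin d) (t : ℝ) :
    dot k (t • EuclideanSpace.single j 1) = k j * t := by
  rw [dot, Finset.sum_eq_single j]
  · rw [PiLp.smul_apply, PiLp.single_apply, if_pos rfl, smul_eq_mul, mul_one]
  · intro b _ hb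
    rw [PiLp.smul_apply, PiLp.single_apply, if_neg hb, smul_zero, mul_zero]
  · exact fun h => (h (Finset.mem_univ j)).elim

theorem pd_inr_mode (k : Fin d → ℤ) (j : Fin d) (f : families d I) :
    pd (Sum.inr j) (mode k f) = (Complex.I * k j) • mode k f := by
  ext i ⟨p, q⟩
  have h1 : HasDerivAt (fun t : ℝ => (mode k f).1 i ((p, q) + t • coordDir (Sum.inr j)))
      ((pd (Sum.inr j) (mode k f)).1 i (p, q)) 0 := by
    have hd : HasFDerivAt ((mode k f).1 i) (fderiv ℝ ((mode k f).1 i) (p, q))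
        ((p, q) + (0 : ℝ) • coordDir (Sum.inr j)) := by
      simpa using (families_differentiable (mode k f) i (p, q)).hasFDerivAt
    have hl : HasDerivAt (fun t : ℝ => ((p, q) : Phase d) + t • coordDir (Sum.inr j))
        (coordDir (Sum.inr j)) 0 := by
      simpa using ((hasDerivAt_id (0 : ℝ)).smul_const (coordDir (Sum.inr j))).const_add (p, q)
    exact hd.comp_hasDerivAt (0 : ℝ) hl
  have h2 : (fun t : ℝ => (mode k f).1 i ((p, q) + t • coordDir (Sum.inr j))) =
      fun t : ℝ => Complex.exp (Complex.I * (k j * t : ℝ)) * (mode k f).1 i (p, q) := by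
    ext t
    have := mode_translate k f i p q (t • EuclideanSpace.single j 1)
    rw [dot_single] at this
    simpa [coordDir] using this
  have h3 : HasDerivAt (fun t : ℝ => Complex.exp (Complex.I * (k j * t : ℝ)) *
      (mode k f).1 i (p, q)) (Complex.I * k j * (mode k f).1 i (p, q)) 0 := by
    have ha : HasDerivAt (fun t : ℝ => ((k j * t : ℝ) : ℂ)) (k j) 0 := by
      have := ((hasDerivAt_id (0 : ℝ)).const_mul (k j : ℝ)).ofReal_comp
      simpa using this
    have := ((ha.const_mul Complex.I).cexp).mul_const ((mode k f).1 i (p, q))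
    simpa using this
  rw [h2] at h1
  exact h1.unique h3

theorem norm_mode_le (k : Fin d → ℤ) {f : families d I} {i : I} {z : Phase d} {C : ℝ}
    (h : ∀ z' : Phase d, z'.1 = z.1 → ‖f.1 i z'‖ ≤ C) : ‖(mode k f).1 i z‖ ≤ C := by
  rw [mode_apply]
  have := norm_integral_le_of_norm_le_const (μ := torusMeasure d)
    (f := fun θ => UnitAddTorus.mFourier (-k) θ • f.1 i (z + (0, torusSection θ))) (C := C)
    (Filter.Eventually.of_forall fun θ => by
      rw [norm_smul, norm_mFourier_apply, one_mul]
      exact h _ (by simp))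
  simpa using this

theorem mode_iterPd_replicate (k : Fin d → ℤ) (j : Fin d) (m : ℕ) (f : families d I) :
    mode k (iterPd (List.replicate m (Sum.inr j)) f) = (Complex.I * k j) ^ m • mode k f := by
  induction m generalizing f with
  | zero => simp
  | succ m ih => rw [List.replicate_succ, iterPd_cons, ih, ← pd_mode, pd_inr_mode, smul_smul,
      pow_succ]

theorem exists_mode_decay {f : families d I} (hf : f ∈ unifSmooth d I) (m : ℕ) :
    ∃ C : ℝ, 0 ≤ C ∧ ∀ (k : Fin d → ℤ) (i : I) (z : Phase d), ‖z.1‖ ≤ 1 →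
      ‖k‖ ^ m * ‖(mode k f).1 i z‖ ≤ C := by
  have h : ∀ j : Fin d, ∃ C : ℝ, ∀ i (z : Phase d), ‖z.1‖ ≤ 1 →
      ‖(iterPd (List.replicate m (Sum.inr j)) f).1 i z‖ ≤ C := fun j => hf _
  choose C hC using h
  obtain ⟨C₀, hC₀⟩ := unifSmooth.unifBdd hf
  refine ⟨|C₀| + ∑ j, |C j|, by positivity, fun k i z hz => ?_⟩
  rcases isEmpty_or_nonempty (Fin d) with he | hne
  · have h1 : ‖k‖ ^ m ≤ 1 := by
      rw [Subsingleton.elim k 0, norm_zero]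
      exact pow_le_one₀ le_rfl zero_le_one
    have h2 := norm_mode_le k (f := f) (i := i) (z := z) (C := C₀) fun z' hz' =>
      hC₀ i z' (by rw [hz']; exact hz)
    have : ‖k‖ ^ m * ‖(mode k f).1 i z‖ ≤ 1 * C₀ :=
      mul_le_mul h1 h2 (norm_nonneg _) zero_le_one
    have h3 : 0 ≤ ∑ j, |C j| := by positivity
    linarith [le_abs_self C₀]
  · obtain ⟨j, hj⟩ := Finite.exists_max fun j => ‖k j‖
    have h1 : ‖k‖ ≤ ‖k j‖ := (pi_norm_le_iff_of_nonneg (norm_nonneg _)).2 hj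
    have h2 := norm_mode_le k (f := iterPd (List.replicate m (Sum.inr j)) f) (i := i) (z := z)
      (C := C j) fun z' hz' => hC j i z' (by rw [hz']; exact hz)
    rw [mode_iterPd_replicate] at h2
    change ‖(Complex.I * k j) ^ m • (mode k f).1 i z‖ ≤ C j at h2
    rw [norm_smul, norm_pow, norm_mul, Complex.norm_I, one_mul] at h2
    have h3 : ‖((k j : ℤ) : ℂ)‖ = ‖k j‖ := by
      rw [Complex.norm_intCast, Int.norm_eq_abs]
    rw [h3] at h2
    have h4 : ‖k‖ ^ m * ‖(mode k f).1 i z‖ ≤ ‖k j‖ ^ m * ‖(mode k f).1 i z‖ :=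
      mul_le_mul_of_nonneg_right (pow_le_pow_left₀ (norm_nonneg _) h1 m) (norm_nonneg _)
    have h5 : |C j| ≤ ∑ j, |C j| :=
      Finset.single_le_sum (f := fun j => |C j|) (fun _ _ => abs_nonneg _) (Finset.mem_univ j)
    linarith [le_abs_self (C j), abs_nonneg C₀]

theorem summable_pi_prod {g : ℤ → ℝ} (hg0 : ∀ n, 0 ≤ g n) (hg : Summable g) :
    Summable fun k : Fin d → ℤ => ∏ j, g (k j) := by
  classical
  refine summable_of_sum_le (c := ∏ _j : Fin d, ∑' n, g n)
    (fun k => Finset.prod_nonneg fun j _ => hg0 _) fun s => ?_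
  calc ∑ k ∈ s, ∏ j, g (k j)
      ≤ ∑ k ∈ Fintype.piFinset fun j => s.image fun k => k j, ∏ j, g (k j) :=
        Finset.sum_le_sum_of_subset_of_nonneg
          (fun k hk => Fintype.mem_piFinset.2 fun j => Finset.mem_image_of_mem _ hk)
          fun k _ _ => Finset.prod_nonneg fun j _ => hg0 _
    _ = ∏ j, ∑ n ∈ s.image (fun k => k j), g n := (Finset.prod_univ_sum _ _).symm
    _ ≤ ∏ _j : Fin d, ∑' n, g n := Finset.prod_le_prod
        (fun j _ => Finset.sum_nonneg fun n _ => hg0 n)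
        fun j _ => hg.sum_le_tsum _ fun n _ => hg0 n

theorem summable_one_add_norm_pow :
    Summable fun k : Fin d → ℤ => ((1 + ‖k‖) ^ (2 * d))⁻¹ := by
  have h1 : Summable fun n : ℤ => ((1 + ‖n‖) ^ 2)⁻¹ := by
    have h := Real.summable_one_div_int_pow.2 (one_lt_two)
    refine Summable.of_norm_bounded_eventually (g := fun n : ℤ => 1 / (n : ℝ) ^ 2) h ?_
    refine (Set.finite_singleton (0 : ℤ)).subset fun n hn => ?_
    by_contra h0
    refine hn ?_
    simp only [Set.mem_singleton_iff] at h0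
    have h0' : 0 < |(n : ℝ)| := abs_pos.2 (by exact_mod_cast h0)
    change ‖((1 + ‖n‖) ^ 2)⁻¹‖ ≤ 1 / (n : ℝ) ^ 2
    rw [Real.norm_of_nonneg (by positivity), Int.norm_eq_abs, one_div, ← sq_abs (n : ℝ)]
    gcongr
    linarith
  refine Summable.of_nonneg_of_le (fun k => by positivity) (fun k => ?_)
    (summable_pi_prod (fun n => by positivity) h1)
  rw [Finset.prod_inv_distrib]
  gcongr
  · calc ∏ j, (1 + ‖k j‖) ^ 2 ≤ ∏ _j : Fin d, (1 + ‖k‖) ^ 2 := by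
          refine Finset.prod_le_prod (fun j _ => by positivity) fun j _ => ?_
          gcongr
          exact norm_le_pi_norm k j
      _ = (1 + ‖k‖) ^ (2 * d) := by simp [pow_mul]

/-- A summable sequence dominating the modes of a family, with any polynomial weight. -/
theorem exists_summable_mode {f : families d I} (hf : f ∈ unifSmooth d I) (m : ℕ) :
    ∃ u : (Fin d → ℤ) → ℝ, Summable u ∧ (∀ k, 0 ≤ u k) ∧
      ∀ (k : Fin d → ℤ) (i : I) (z : Phase d), ‖z.1‖ ≤ 1 →
        (1 + ‖k‖) ^ m * ‖(mode k f).1 i z‖ ≤ u k := by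
  obtain ⟨C, hC0, hC⟩ := exists_mode_decay hf 0
  obtain ⟨D, hD0, hD⟩ := exists_mode_decay hf (m + 2 * d)
  refine ⟨fun k => 2 ^ (m + 2 * d) * (C + D) * ((1 + ‖k‖) ^ (2 * d))⁻¹,
    summable_one_add_norm_pow.mul_left _, fun k => by positivity, fun k i z hz => ?_⟩
  dsimp only
  rw [← div_eq_mul_inv, le_div_iff₀ (by positivity)]
  set a := ‖(mode k f).1 i z‖ with ha
  have h1 : (1 + ‖k‖) ^ m * a * (1 + ‖k‖) ^ (2 * d) = (1 + ‖k‖) ^ (m + 2 * d) * a := by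
    rw [pow_add]; ring
  have h2 := hC k i z hz
  have h3 := hD k i z hz
  rw [pow_zero, one_mul] at h2
  rw [h1]
  have h4 : (1 + ‖k‖) ^ (m + 2 * d) ≤ 2 ^ (m + 2 * d) * (1 + ‖k‖ ^ (m + 2 * d)) := by
    rcases le_total ‖k‖ 1 with hk | hk
    · calc (1 + ‖k‖) ^ (m + 2 * d) ≤ 2 ^ (m + 2 * d) := by gcongr; linarith
        _ ≤ _ := le_mul_of_one_le_right (by positivity) (by linarith [pow_nonneg (norm_nonneg k) (m + 2 * d)])
    · calc (1 + ‖k‖) ^ (m + 2 * d) ≤ (2 * ‖k‖) ^ (m + 2 * d) := by gcongr; linarith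
        _ = 2 ^ (m + 2 * d) * ‖k‖ ^ (m + 2 * d) := mul_pow _ _ _
        _ ≤ _ := by gcongr; linarith
  calc (1 + ‖k‖) ^ (m + 2 * d) * a ≤ 2 ^ (m + 2 * d) * (1 + ‖k‖ ^ (m + 2 * d)) * a := by gcongr
    _ = 2 ^ (m + 2 * d) * (a + ‖k‖ ^ (m + 2 * d) * a) := by ring
    _ ≤ 2 ^ (m + 2 * d) * (C + D) := by gcongr

theorem hasSum_mode {f : families d I} (hf : f ∈ unifSmooth d I) (i : I) (z : Phase d)
    (hz : ‖z.1‖ ≤ 1) : HasSum (fun k => (mode k f).1 i z) (f.1 i z) := by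
  obtain ⟨u, hu, -, hub⟩ := exists_summable_mode hf 0
  let F : C(UnitAddTorus (Fin d), ℂ) :=
    ⟨fun θ => f.1 i (z.1, z.2 + torusSection θ), continuous_apply_torusSection f i z.1 z.2⟩
  have hF : ∀ k, UnitAddTorus.mFourierCoeff F k = (mode k f).1 i z := fun k => by
    rw [UnitAddTorus.mFourierCoeff, mode_apply]
    refine integral_congr_ae (Filter.Eventually.of_forall fun θ => ?_)
    dsimp only
    rw [show z + (0, torusSection θ) = (z.1, z.2 + torusSection θ) by simp [Prod.ext_iff]]
    rfl
  have hs : Summable (UnitAddTorus.mFourierCoeff F) :=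
    Summable.of_norm_bounded hu fun k => by
      rw [hF]
      simpa using hub k i z hz
  have h := UnitAddTorus.hasSum_mFourier_series_apply_of_summable hs 0
  have e0 : ∀ k : Fin d → ℤ, UnitAddTorus.mFourier k 0 = 1 := fun k => by
    simp [UnitAddTorus.mFourier]
  have e1 : F 0 = f.1 i z := by
    have h0 : toUnitTorus (0 : EuclideanSpace ℝ (Fin d)) = 0 := by
      ext j
      simp [toUnitTorus]
    change f.1 i (z.1, z.2 + torusSection 0) = _
    rw [← h0, apply_add_torusSection, add_zero]
  simpa [hF, e0, e1] using h

/-- The Fourier multiplier with finitely many nonzero coefficients, for each value of the index. -/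
def mult (F : I → Finset (Fin d → ℤ)) (c : I → (Fin d → ℤ) → ℂ) (f : families d I) :
    families d I :=
  ⟨fun i z => ∑ k ∈ F i, c i k * (mode k f).1 i z, fun i =>
    ⟨ContDiff.sum fun k _ => contDiff_const.mul (families_contDiff (mode k f) i),
      fun p q n => by simp [families_periodic]⟩⟩

theorem mult_apply (F : I → Finset (Fin d → ℤ)) (c : I → (Fin d → ℤ) → ℂ) (f : families d I)
    (i : I) (z : Phase d) : (mult F c f).1 i z = ∑ k ∈ F i, c i k * (mode k f).1 i z := rfl

theorem pd_mult_apply (a : Fin d ⊕ Fin d) (F : I → Finset (Fin d → ℤ)) (c : I → (Fin d → ℤ) → ℂ)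
    (f : families d I) (i : I) (z : Phase d) :
    (pd a (mult F c f)).1 i z = ∑ k ∈ F i, c i k * (pd a (mode k f)).1 i z := by
  rw [pd_apply]
  change fderiv ℝ (fun z => ∑ k ∈ F i, c i k * (mode k f).1 i z) z _ = _
  rw [fderiv_fun_sum fun k _ => (families_differentiable (mode k f) i z).const_mul (c i k)]
  rw [sum_apply]
  refine Finset.sum_congr rfl fun k _ => ?_
  rw [fderiv_const_mul (families_differentiable (mode k f) i z)]
  rfl

theorem pd_mult (a : Fin d ⊕ Fin d) (F : I → Finset (Fin d → ℤ)) (c : I → (Fin d → ℤ) → ℂ)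
    (f : families d I) : pd a (mult F c f) = mult F c (pd a f) := by
  ext i z
  rw [pd_mult_apply]
  simp only [pd_mode]
  rfl

theorem iterPd_mult (l : List (Fin d ⊕ Fin d)) (F : I → Finset (Fin d → ℤ))
    (c : I → (Fin d → ℤ) → ℂ) (f : families d I) :
    iterPd l (mult F c f) = mult F c (iterPd l f) := by
  induction l generalizing f with
  | nil => rfl
  | cons a l ih => rw [iterPd_cons, iterPd_cons, pd_mult, ih]

theorem iterPd_mem {f : families d I} (hf : f ∈ unifSmooth d I) (l : List (Fin d ⊕ Fin d)) :
    iterPd l f ∈ unifSmooth d I := by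
  induction l generalizing f with
  | nil => exact hf
  | cons a l ih => exact ih (pd_mem hf a)

theorem mult_mem_unifSmooth {F : I → Finset (Fin d → ℤ)} {c : I → (Fin d → ℤ) → ℂ}
    (hc : ∀ i, ∀ k ∈ F i, ‖c i k‖ ≤ 1) {f : families d I} (hf : f ∈ unifSmooth d I) :
    mult F c f ∈ unifSmooth d I := by
  intro l
  rw [iterPd_mult]
  obtain ⟨u, hu, hu0, hub⟩ := exists_summable_mode (iterPd_mem hf l) 0
  refine ⟨∑' k, u k, fun i z hz => ?_⟩
  rw [mult_apply]
  calc ‖∑ k ∈ F i, c i k * (mode k (iterPd l f)).1 i z‖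
      ≤ ∑ k ∈ F i, ‖c i k * (mode k (iterPd l f)).1 i z‖ := norm_sum_le _ _
    _ ≤ ∑ k ∈ F i, u k := Finset.sum_le_sum fun k hk => by
        rw [norm_mul]
        have h1 := hub k i z hz
        rw [pow_zero, one_mul] at h1
        have h2 := hc i k hk
        nlinarith [norm_nonneg ((mode k (iterPd l f)).1 i z)]
    _ ≤ ∑' k, u k := hu.sum_le_tsum _ fun k _ => hu0 k

theorem poisson_linHam_apply (v : I → Momentum d) (f : families d I) (i : I) (z : Phase d) :
    (poisson (linHam v) f).1 i z = -∑ j, ((v i j : ℝ) : ℂ) * (pd (Sum.inr j) f).1 i z := by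
  rw [poisson_linHam]
  simp

theorem pd_poisson_linHam (a : Fin d ⊕ Fin d) (v : I → Momentum d) (f : families d I) :
    pd a (poisson (linHam v) f) = poisson (linHam v) (pd a f) := by
  simp only [poisson_linHam, map_neg, map_sum, pd_cst_mul, pd_comm a]

theorem iterPd_poisson_linHam (l : List (Fin d ⊕ Fin d)) (v : I → Momentum d) (f : families d I) :
    iterPd l (poisson (linHam v) f) = poisson (linHam v) (iterPd l f) := by
  induction l generalizing f with
  | nil => rfl
  | cons a l ih => rw [iterPd_cons, iterPd_cons, pd_poisson_linHam, ih]

theorem sum_pd_mode (v : Momentum d) (k : Fin d → ℤ) (f : families d I) (i : I) (z : Phase d) :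
    ∑ j, ((v j : ℝ) : ℂ) * (pd (Sum.inr j) (mode k f)).1 i z =
      Complex.I * dot k v * (mode k f).1 i z := by
  simp only [pd_inr_mode]
  change ∑ j, ((v j : ℝ) : ℂ) * (Complex.I * k j * (mode k f).1 i z) = _
  simp only [dot]
  push_cast
  rw [Finset.mul_sum, Finset.sum_mul]
  exact Finset.sum_congr rfl fun j _ => by ring

theorem poisson_linHam_mult_apply (v : I → Momentum d) (F : I → Finset (Fin d → ℤ))
    (c : I → (Fin d → ℤ) → ℂ) (f : families d I) (i : I) (z : Phase d) :
    (poisson (linHam v) (mult F c f)).1 i z =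
      -∑ k ∈ F i, c i k * (Complex.I * dot k (v i) * (mode k f).1 i z) := by
  rw [poisson_linHam_apply]
  simp only [pd_mult_apply, Finset.mul_sum]
  rw [Finset.sum_comm]
  congr 1
  refine Finset.sum_congr rfl fun k _ => ?_
  rw [← sum_pd_mode, Finset.mul_sum]
  exact Finset.sum_congr rfl fun j _ => by ring

theorem abs_dot_le (k : Fin d → ℤ) (v : Momentum d) : |dot k v| ≤ d * ‖v‖ * ‖k‖ := by
  calc |dot k v| ≤ ∑ j, |(k j : ℝ) * v j| := Finset.abs_sum_le_sum_abs _ _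
    _ ≤ ∑ _j : Fin d, ‖v‖ * ‖k‖ := Finset.sum_le_sum fun j _ => by
        rw [abs_mul, mul_comm]
        have h1 := PiLp.norm_apply_le v j
        have h2 := norm_le_pi_norm k j
        rw [Int.norm_eq_abs] at h2
        exact mul_le_mul h1 h2 (abs_nonneg _) (norm_nonneg _)
    _ = d * ‖v‖ * ‖k‖ := by simp [mul_assoc]

theorem finite_norm_le (K : ℝ) : {k : Fin d → ℤ | ‖k‖ ≤ K}.Finite := by
  have := (isCompact_closedBall (0 : Fin d → ℤ) K).finite_of_discrete
  simpa [Metric.closedBall, dist_eq_norm] using this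

/-- The frequencies that are eliminated by the homological equation. -/
def elimSet (X : ℝ) (v : Momentum d) : Finset (Fin d → ℤ) := by
  classical
  exact (finite_norm_le (max X (d * ‖v‖))).toFinset.filter fun k => 1 ≤ |dot k v|

theorem mem_elimSet {X : ℝ} {v : Momentum d} {k : Fin d → ℤ} :
    k ∈ elimSet X v ↔ ‖k‖ ≤ max X (d * ‖v‖) ∧ 1 ≤ |dot k v| := by
  classical
  simp [elimSet]

theorem exists_remainder_bound {X : I → ℝ} {v : I → Momentum d} (hX : ∀ i, 1 ≤ X i)
    (gap : ∀ i k, ‖k‖ ≤ X i → dot k (v i) = 0 ∨ 1 ≤ |dot k (v i)|) {f : families d I}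
    (hf : f ∈ unifSmooth d I) (n : ℕ) :
    UnifBdd (cst (fun i => (X i : ℂ) ^ n) *
      poisson (linHam v) (f - mult (fun i => elimSet (X i) (v i)) (fun _ _ => 1) f)) := by
  obtain ⟨u, hu, hu0, hub⟩ := exists_summable_mode hf (n + 2)
  refine ⟨∑' k, u k, fun i z hz => ?_⟩
  set F := elimSet (X i) (v i) with hF
  have hD : HasSum (fun k => Complex.I * dot k (v i) * (mode k f).1 i z)
      (-(poisson (linHam v) f).1 i z) := by
    rw [poisson_linHam_apply, neg_neg]
    simp_rw [← sum_pd_mode, pd_mode]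
    exact hasSum_sum fun j _ => (hasSum_mode (pd_mem hf _) i z hz).mul_left _
  have hM : HasSum (fun k => if k ∈ F then Complex.I * dot k (v i) * (mode k f).1 i z else 0)
      (-(poisson (linHam v) (mult (fun i => elimSet (X i) (v i)) (fun _ _ => 1) f)).1 i z) := by
    rw [poisson_linHam_mult_apply, neg_neg]
    have h := hasSum_sum_of_ne_finset_zero (L := .unconditional _) (s := F)
      (f := fun k => if k ∈ F then Complex.I * dot k (v i) * (mode k f).1 i z else 0)
      (fun k hk => if_neg hk)
    convert h using 1
    exact Finset.sum_congr rfl fun k hk => by rw [if_pos hk, one_mul]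
  have hS := (hD.sub hM).mul_left ((X i : ℂ) ^ n)
  have e : (cst (fun i => (X i : ℂ) ^ n) * poisson (linHam v)
      (f - mult (fun i => elimSet (X i) (v i)) (fun _ _ => 1) f)).1 i z =
      -((X i : ℂ) ^ n * (-(poisson (linHam v) f).1 i z - -(poisson (linHam v)
        (mult (fun i => elimSet (X i) (v i)) (fun _ _ => 1) f)).1 i z)) := by
    rw [map_sub]
    change (X i : ℂ) ^ n * ((poisson (linHam v) f).1 i z - (poisson (linHam v)
        (mult (fun i => elimSet (X i) (v i)) (fun _ _ => 1) f)).1 i z) = _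
    ring
  rw [e, norm_neg, ← hS.tsum_eq]
  refine tsum_of_norm_bounded hu.hasSum fun k => ?_
  by_cases hk : k ∈ F
  · simp [hk, hu0 k]
  rw [if_neg hk, sub_zero]
  by_cases h0 : dot k (v i) = 0
  · simp [h0, hu0 k]
  have hX0 : 0 ≤ X i := zero_le_one.trans (hX i)
  have hkX : X i ≤ ‖k‖ := by
    by_contra hlt
    push Not at hlt
    refine hk (mem_elimSet.2 ⟨hlt.le.trans (le_max_left _ _), ?_⟩)
    exact (gap i k hlt.le).resolve_left h0
  have hdot : |dot k (v i)| ≤ (1 + ‖k‖) ^ 2 := by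
    by_cases h1 : 1 ≤ |dot k (v i)|
    · have h2 : d * ‖v i‖ ≤ ‖k‖ := by
        by_contra hlt
        push Not at hlt
        exact hk (mem_elimSet.2 ⟨hlt.le.trans (le_max_right _ _), h1⟩)
      calc |dot k (v i)| ≤ d * ‖v i‖ * ‖k‖ := abs_dot_le _ _
        _ ≤ ‖k‖ * ‖k‖ := by gcongr
        _ ≤ (1 + ‖k‖) ^ 2 := by nlinarith [norm_nonneg k]
    · nlinarith [norm_nonneg k]
  refine le_trans ?_ (hub k i z hz)
  rw [norm_mul, norm_mul, norm_mul, norm_pow, Complex.norm_I, one_mul, Complex.norm_real,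
    Complex.norm_real, Real.norm_of_nonneg hX0, ← mul_assoc, pow_add]
  gcongr
  · linarith
  · exact hdot

/-- Solution of the homological equation up to a term that almost commutes with `linHam v`. -/
theorem exists_homological_solution {X : I → ℝ} {v : I → Momentum d} (hX : ∀ i, 1 ≤ X i)
    (gap : ∀ i k, ‖k‖ ≤ X i → dot k (v i) = 0 ∨ 1 ≤ |dot k (v i)|) (f : families d I)
    (hf : f ∈ unifSmooth d I) :
    ∃ χ ∈ unifSmooth d I, ∃ z ∈ unifSmooth d I, f = poisson (linHam v) χ + z ∧
      poisson (linHam v) z ∈ negligible d X := by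
  set F := fun i => elimSet (X i) (v i) with hF
  refine ⟨mult F (fun i k => -(Complex.I * dot k (v i))⁻¹) f, mult_mem_unifSmooth ?_ hf,
    f - mult F (fun _ _ => 1) f, Submodule.sub_mem _ hf (mult_mem_unifSmooth (by simp) hf), ?_, ?_⟩
  · intro i k hk
    rw [norm_neg, norm_inv, norm_mul, Complex.norm_I, one_mul, Complex.norm_real]
    exact inv_le_one_of_one_le₀ (mem_elimSet.1 hk).2
  · have : poisson (linHam v) (mult F (fun i k => -(Complex.I * dot k (v i))⁻¹) f) =
        mult F (fun _ _ => 1) f := by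
      ext i z
      rw [poisson_linHam_mult_apply, mult_apply, ← Finset.sum_neg_distrib]
      refine Finset.sum_congr rfl fun k hk => ?_
      have h1 : dot k (v i) ≠ 0 := fun h0 => by
        have := (mem_elimSet.1 hk).2
        rw [h0, abs_zero] at this
        linarith
      have h2 : (Complex.I * dot k (v i)) ≠ 0 :=
        mul_ne_zero Complex.I_ne_zero (by exact_mod_cast h1)
      rw [neg_mul, neg_neg, ← mul_assoc, inv_mul_cancel₀ h2]
    rw [this]
    abel
  · intro n l
    rw [iterPd_cst_mul, iterPd_poisson_linHam, map_sub, iterPd_mult]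
    exact exists_remainder_bound hX gap (iterPd_mem hf l) n

/-- Partial sums of formal integrals are approximate integrals. -/
theorem poisson_partial_sum (J : ℕ → families d I) (h f : families d I) (h0 : J 0 = h) (c : I → ℂ)
    (M : ℕ) : poisson (∑ n ∈ Finset.range (M + 1), cst (fun i => c i ^ n) * J n) (h + cst c * f) =
      ∑ n ∈ Finset.range M, cst (fun i => c i ^ (n + 1)) *
        (poisson (J (n + 1)) h + poisson (J n) f) +
      cst (fun i => c i ^ (M + 1)) * poisson (J M) f := by
  have hcc : ∀ n, (cst (fun i => c i ^ n) * cst c : families d I) =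
      cst (fun i => c i ^ (n + 1)) := fun n => by
    ext i z
    exact (pow_succ (c i) n).symm
  induction M with
  | zero =>
    have hc0 : (cst (fun i => c i ^ 0) : families d I) = 1 := by
      ext i z
      exact pow_zero (c i)
    rw [zero_add, Finset.sum_range_one, Finset.sum_range_zero, hc0, one_mul, map_add,
      poisson_cst_mul_right, h0, poisson_self]
    simp
  | succ M ih =>
    rw [Finset.sum_range_succ, LinearMap.map_add₂, ih, Finset.sum_range_succ,
      poisson_cst_mul_left, map_add, poisson_cst_mul_right, mul_add, ← mul_assoc, hcc]
    ring

theorem exists_approx_integral_family {X η : I → ℝ} {v : I → Momentum d} (hX : ∀ i, 1 ≤ X i)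
    (hη0 : ∀ i, 0 ≤ η i) (hη1 : ∀ i, η i ≤ 1)
    (gap : ∀ i k, ‖k‖ ≤ X i → dot k (v i) = 0 ∨ 1 ≤ |dot k (v i)|) {g : families d I}
    (hg : g ∈ unifSmooth d I) (N : ℕ) :
    ∃ G A B R : families d I, A ∈ unifSmooth d I ∧ B ∈ unifSmooth d I ∧ R ∈ unifSmooth d I ∧
      G = linHam v + cst (fun i => ((η i / X i : ℝ) : ℂ)) * A +
        cst (fun i => (((1 / X i) ^ 2 : ℝ) : ℂ)) * B ∧
      cst (fun i => (X i : ℂ) ^ N) * poisson G (linHam v + cst (fun i => ((1 / X i : ℝ) : ℂ)) *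
        (kinetic + cst (fun i => (η i : ℂ)) * g)) = R := by
  have hX0 : ∀ i, 0 < X i := fun i => one_pos.trans_le (hX i)
  have hinv : ∀ i, 1 / X i ≤ 1 := fun i => by
    rw [div_le_one (hX0 i)]; exact hX i
  have hηU : (cst (fun i => (η i : ℂ)) : families d I) ∈ unifSmooth d I :=
    cst_mem_unifSmooth (C := 1) fun i => by
      rw [Complex.norm_real, Real.norm_of_nonneg (hη0 i)]; exact hη1 i
  have hpow : ∀ n, (cst (fun i => ((1 / X i : ℝ) : ℂ) ^ n) : families d I) ∈ unifSmooth d I :=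
    fun n => cst_mem_unifSmooth (C := 1) fun i => by
      rw [norm_pow, Complex.norm_real, Real.norm_of_nonneg (by have := hX0 i; positivity)]
      exact pow_le_one₀ (by have := hX0 i; positivity) (hinv i)
  obtain ⟨χ, hχ, y, hy, hgy, hym⟩ := exists_homological_solution hX gap g hg
  have hfU : kinetic + cst (fun i => (η i : ℂ)) * g ∈ unifSmooth d I :=
    Submodule.add_mem _ kinetic_mem_unifSmooth (mul_mem_unifSmooth hηU hg)
  obtain ⟨J, hJ0, hJ1, hJU, hJm⟩ := exists_formal_integral (poisson (d := d) (I := I))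
    (U := unifSmooth d I) (m := negligible d X) poisson_leibniz
    (fun f hf g hg => poisson_mem_unifSmooth hf hg) (fun f hf g hg => poisson_mem_negligible hf hg)
    (poisson_self (linHam v)) (exists_homological_solution hX gap)
    (f₁ := kinetic + cst (fun i => (η i : ℂ)) * g) (w₁ := cst (fun i => (η i : ℂ)) * χ)
    (z₁ := kinetic + cst (fun i => (η i : ℂ)) * y) hfU (mul_mem_unifSmooth hηU hχ)
    (Submodule.add_mem _ kinetic_mem_unifSmooth (mul_mem_unifSmooth hηU hy))
    (by rw [poisson_cst_mul_right]; nth_rewrite 1 [hgy]; ring)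
    (by
      rw [map_add, poisson_linHam_kinetic, zero_add, poisson_cst_mul_right]
      intro n
      rw [mul_left_comm]
      exact mul_mem_unifSmooth hηU (hym n)) (N + 1)
  refine ⟨∑ n ∈ Finset.range (N + 1 + 1), cst (fun i => ((1 / X i : ℝ) : ℂ) ^ n) * J n,
    poisson (linHam v) χ, ∑ n ∈ Finset.range N, cst (fun i => ((1 / X i : ℝ) : ℂ) ^ n) * J (n + 2),
    _, ?_, ?_, ?_, ?_, rfl⟩
  · rw [show poisson (linHam v) χ = g - y by rw [hgy]; abel]
    exact Submodule.sub_mem _ hg hy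
  · exact Submodule.sum_mem _ fun n _ => mul_mem_unifSmooth (hpow n) (hJU (n + 1))
  · rw [poisson_partial_sum J _ _ hJ0, mul_add, Finset.mul_sum]
    refine Submodule.add_mem _ (Submodule.sum_mem _ fun n hn => ?_) ?_
    · rw [mul_left_comm]
      exact mul_mem_unifSmooth (hpow _) (hJm n (Finset.mem_range.1 hn) N)
    · have e : (cst (fun i => (X i : ℂ) ^ N) * cst (fun i => ((1 / X i : ℝ) : ℂ) ^ (N + 1 + 1)) :
          families d I) = cst (fun i => ((1 / X i : ℝ) : ℂ) ^ 2) := by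
        ext i z
        change (X i : ℂ) ^ N * ((1 / X i : ℝ) : ℂ) ^ (N + 1 + 1) = ((1 / X i : ℝ) : ℂ) ^ 2
        have : (X i : ℂ) ≠ 0 := by exact_mod_cast (hX0 i).ne'
        push_cast
        rw [show N + 1 + 1 = N + 2 by ring, pow_add, ← mul_assoc, ← mul_pow,
          mul_one_div_cancel this, one_pow, one_mul]
      rw [← mul_assoc, e]
      exact mul_mem_unifSmooth (hpow _) (poisson_mem_unifSmooth (hJU N) hfU)
  · rw [Finset.sum_range_succ', Finset.sum_range_succ', hJ0, zero_add, hJ1, Finset.mul_sum]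
    have e1 : ∀ n, (cst (fun i => ((1 / X i : ℝ) : ℂ) ^ (n + 1 + 1)) * J (n + 1 + 1) :
        families d I) = cst (fun i => (((1 / X i) ^ 2 : ℝ) : ℂ)) *
          (cst (fun i => ((1 / X i : ℝ) : ℂ) ^ n) * J (n + 2)) := fun n => by
      rw [← mul_assoc]
      congr 1
      ext i z
      change ((1 / X i : ℝ) : ℂ) ^ (n + 2) =
        (((1 / X i) ^ 2 : ℝ) : ℂ) * ((1 / X i : ℝ) : ℂ) ^ n
      push_cast
      ring
    have e2 : (cst (fun i => ((1 / X i : ℝ) : ℂ) ^ 1) *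
        poisson (linHam v) (cst (fun i => (η i : ℂ)) * χ) : families d I) =
        cst (fun i => ((η i / X i : ℝ) : ℂ)) * poisson (linHam v) χ := by
      rw [poisson_cst_mul_right, ← mul_assoc]
      congr 1
      ext i z
      change ((1 / X i : ℝ) : ℂ) ^ 1 * (η i : ℂ) = ((η i / X i : ℝ) : ℂ)
      push_cast
      ring
    have e3 : (cst (fun i => ((1 / X i : ℝ) : ℂ) ^ 0) * linHam v : families d I) = linHam v := by
      ext i z
      change ((1 / X i : ℝ) : ℂ) ^ 0 * (linHam v).1 i z = _
      rw [pow_zero, one_mul]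
    rw [e2, e3, Finset.sum_congr rfl fun n _ => e1 n]
    ring

section Resonances

/-- The integer lattice in `ℝ^d`. -/
def intLattice (d : ℕ) : AddSubgroup (EuclideanSpace ℝ (Fin d)) where
  carrier := {x | ∀ j, ∃ n : ℤ, x j = n}
  add_mem' := fun {x y} hx hy j => by
    obtain ⟨m, hm⟩ := hx j
    obtain ⟨n, hn⟩ := hy j
    exact ⟨m + n, by simp [hm, hn]⟩
  zero_mem' := fun j => ⟨0, by simp⟩
  neg_mem' := fun {x} hx j => by
    obtain ⟨m, hm⟩ := hx j
    exact ⟨-m, by simp [hm]⟩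

theorem smul_mem_intLattice {x : EuclideanSpace ℝ (Fin d)} (hx : x ∈ intLattice d) {c : ℝ}
    (hc : ∃ n : ℤ, c = n) : c • x ∈ intLattice d := fun j => by
  obtain ⟨m, hm⟩ := hx j
  obtain ⟨n, hn⟩ := hc
  exact ⟨n * m, by simp [hm, hn]⟩

theorem inner_intLattice {x y : EuclideanSpace ℝ (Fin d)} (hx : x ∈ intLattice d)
    (hy : y ∈ intLattice d) : ∃ n : ℤ, inner ℝ x y = n := by
  choose m hm using hx
  choose n hn using hy
  refine ⟨∑ j, m j * n j, ?_⟩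
  rw [PiLp.inner_apply]
  push_cast
  exact Finset.sum_congr rfl fun j _ => by rw [hm, hn]; simp [mul_comm]

theorem norm_sq_intLattice {x : EuclideanSpace ℝ (Fin d)} (hx : x ∈ intLattice d) :
    ∃ n : ℤ, ‖x‖ ^ 2 = n := by
  rw [← real_inner_self_eq_norm_sq]
  exact inner_intLattice hx hx

theorem one_le_norm_intLattice {x : EuclideanSpace ℝ (Fin d)} (hx : x ∈ intLattice d)
    (h0 : x ≠ 0) : 1 ≤ ‖x‖ := by
  obtain ⟨n, hn⟩ := norm_sq_intLattice hx
  have hpos : 0 < ‖x‖ := norm_pos_iff.2 h0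
  have h1 : (0 : ℝ) < n := by rw [← hn]; positivity
  have h2 : (1 : ℝ) ≤ n := by exact_mod_cast (show (0 : ℤ) < n by exact_mod_cast h1)
  nlinarith

theorem prod_norm_sq_intLattice {S : Finset (EuclideanSpace ℝ (Fin d))}
    (hS : ∀ x ∈ S, x ∈ intLattice d) : ∃ n : ℤ, ∏ x ∈ S, ‖x‖ ^ 2 = n := by
  classical
  induction S using Finset.induction_on with
  | empty => exact ⟨1, by simp⟩
  | insert x S hx ih =>
    obtain ⟨m, hm⟩ := norm_sq_intLattice (hS x (Finset.mem_insert_self x S))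
    obtain ⟨n, hn⟩ := ih fun y hy => hS y (Finset.mem_insert_of_mem hy)
    exact ⟨m * n, by rw [Finset.prod_insert hx, hm, hn]; push_cast; ring⟩

/-- One step of the Gram–Schmidt process without denominators. -/
theorem exists_orthogonal_intLattice {S : Finset (EuclideanSpace ℝ (Fin d))}
    (hS : ∀ x ∈ S, x ∈ intLattice d)
    (horth : ∀ x ∈ S, ∀ y ∈ S, x ≠ y → inner ℝ x y = 0) {κ : EuclideanSpace ℝ (Fin d)}
    (hκ : κ ∈ intLattice d) :
    ∃ e ∈ intLattice d, (∀ x ∈ S, inner ℝ e x = 0) ∧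
      (∀ w, (∀ x ∈ S, inner ℝ x w = 0) → inner ℝ e w = (∏ x ∈ S, ‖x‖ ^ 2) * inner ℝ κ w) ∧
      ‖e‖ ≤ (∏ x ∈ S, ‖x‖ ^ 2) * ‖κ‖ := by
  classical
  set Q := ∏ x ∈ S, ‖x‖ ^ 2 with hQ
  have hQ0 : 0 ≤ Q := Finset.prod_nonneg fun x _ => by positivity
  obtain ⟨e, he⟩ : ∃ e, e = Q • κ - ∑ x ∈ S, ((∏ y ∈ S.erase x, ‖y‖ ^ 2) * inner ℝ κ x) • x :=
    ⟨_, rfl⟩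
  have he_inner : ∀ w, inner ℝ e w = Q * inner ℝ κ w -
      ∑ x ∈ S, ((∏ y ∈ S.erase x, ‖y‖ ^ 2) * inner ℝ κ x) * inner ℝ x w := fun w => by
    rw [he, inner_sub_left, real_inner_smul_left, sum_inner]
    simp only [real_inner_smul_left]
  have horth' : ∀ x ∈ S, inner ℝ e x = 0 := fun x hx => by
    rw [he_inner, Finset.sum_eq_single x]
    · rw [real_inner_self_eq_norm_sq, hQ, ← Finset.mul_prod_erase S _ hx]
      ring
    · intro y hy hyx
      rw [horth y hy x hx hyx, mul_zero]
    · exact fun h => (h hx).elim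
  refine ⟨e, ?_, horth', fun w hw => ?_, ?_⟩
  · rw [he]
    refine (intLattice d).sub_mem (smul_mem_intLattice hκ (prod_norm_sq_intLattice hS))
      ((intLattice d).sum_mem fun x hx => smul_mem_intLattice (hS x hx) ?_)
    obtain ⟨m, hm⟩ := prod_norm_sq_intLattice (S := S.erase x)
      fun y hy => hS y (Finset.mem_of_mem_erase hy)
    obtain ⟨n, hn⟩ := inner_intLattice hκ (hS x hx)
    exact ⟨m * n, by rw [hm, hn]; push_cast; ring⟩
  · rw [he_inner, Finset.sum_eq_zero fun x hx => by rw [hw x hx, mul_zero], sub_zero]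
  · have h1 : ‖e‖ ^ 2 = Q * inner ℝ e κ := by
      rw [← real_inner_self_eq_norm_sq, he_inner e, real_inner_comm,
        Finset.sum_eq_zero fun x hx => ?_, sub_zero]
      rw [real_inner_comm e x, horth' x hx, mul_zero]
    have h2 := real_inner_le_norm e κ
    rcases (norm_nonneg e).eq_or_lt with h0 | h0
    · exact h0 ▸ mul_nonneg hQ0 (norm_nonneg κ)
    · have h3 : ‖e‖ * ‖e‖ ≤ ‖e‖ * (Q * ‖κ‖) := by
        have := mul_le_mul_of_nonneg_left h2 hQ0
        linarith [sq ‖e‖]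
      exact le_of_mul_le_mul_left h3 h0

/-- The vector of `ℝ^d` with the given integer coordinates. -/
def intVec (k : Fin d → ℤ) : EuclideanSpace ℝ (Fin d) := WithLp.toLp 2 fun j => (k j : ℝ)

theorem intVec_mem (k : Fin d → ℤ) : intVec k ∈ intLattice d := fun j => ⟨k j, rfl⟩

theorem inner_intVec (k : Fin d → ℤ) (w : EuclideanSpace ℝ (Fin d)) :
    inner ℝ (intVec k) w = dot k w := by
  rw [PiLp.inner_apply, dot]
  exact Finset.sum_congr rfl fun j _ => by simp [intVec, mul_comm]

theorem norm_intVec_le (k : Fin d → ℤ) : ‖intVec k‖ ≤ d * ‖k‖ := by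
  have h0 : 0 ≤ ‖intVec k‖ := norm_nonneg _
  have h : ‖intVec k‖ ^ 2 ≤ d * ‖k‖ * ‖intVec k‖ := by
    rw [← real_inner_self_eq_norm_sq, inner_intVec]
    have := (le_abs_self _).trans (abs_dot_le k (intVec k))
    linarith
  rcases h0.eq_or_lt with h0 | h0
  · rw [← h0]; positivity
  · have h3 : ‖intVec k‖ * ‖intVec k‖ ≤ ‖intVec k‖ * (d * ‖k‖) := by linarith
    exact le_of_mul_le_mul_left h3 h0

theorem card_le_of_orthogonal {S : Finset (EuclideanSpace ℝ (Fin d))} (h0 : ∀ x ∈ S, x ≠ 0)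
    (horth : ∀ x ∈ S, ∀ y ∈ S, x ≠ y → inner ℝ x y = 0) : S.card ≤ d := by
  have hli : LinearIndependent ℝ (fun x : S => (x : EuclideanSpace ℝ (Fin d))) :=
    linearIndependent_of_ne_zero_of_inner_eq_zero (𝕜 := ℝ) (fun x => h0 x x.2)
      fun x y hxy => horth x x.2 y y.2 fun h => hxy (Subtype.ext h)
  have := hli.fintype_card_le_finrank
  simpa using this

theorem one_le_prod_norm_sq {S : Finset (EuclideanSpace ℝ (Fin d))}
    (hS : ∀ x ∈ S, x ∈ intLattice d) (hS0 : ∀ x ∈ S, x ≠ 0) : 1 ≤ ∏ x ∈ S, ‖x‖ ^ 2 := by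
  have := Finset.prod_le_prod (s := S) (f := fun _ => (1 : ℝ)) (g := fun x => ‖x‖ ^ 2)
    (fun _ _ => zero_le_one)
    fun x hx => one_le_pow₀ (one_le_norm_intLattice (hS x hx) (hS0 x hx))
  simpa using this

/-- A vector with a small divisor is moved onto one further resonance. -/
theorem exists_resonance_step {S : Finset (EuclideanSpace ℝ (Fin d))}
    {w : EuclideanSpace ℝ (Fin d)} {k : Fin d → ℤ} (hS : ∀ x ∈ S, x ∈ intLattice d)
    (hS0 : ∀ x ∈ S, x ≠ 0) (horth : ∀ x ∈ S, ∀ y ∈ S, x ≠ y → inner ℝ x y = 0)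
    (hw : ∀ x ∈ S, inner ℝ x w = 0) (hk0 : dot k w ≠ 0) :
    ∃ e w' : EuclideanSpace ℝ (Fin d), e ∈ intLattice d ∧ e ≠ 0 ∧ (∀ x ∈ S, inner ℝ e x = 0) ∧
      e ∉ S ∧ inner ℝ e w' = 0 ∧ (∀ x ∈ S, inner ℝ x w' = 0) ∧
      ‖e‖ ≤ (∏ x ∈ S, ‖x‖ ^ 2) * ‖intVec k‖ ∧ ‖w' - w‖ ≤ (∏ x ∈ S, ‖x‖ ^ 2) * |dot k w| := by
  obtain ⟨e, heL, heS, hew, hen⟩ := exists_orthogonal_intLattice hS horth (intVec_mem k)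
  have hQ1 := one_le_prod_norm_sq hS hS0
  have hew' := hew w hw
  rw [inner_intVec] at hew'
  generalize ∏ x ∈ S, ‖x‖ ^ 2 = Q at *
  have hew0 : inner ℝ e w ≠ 0 := by
    rw [hew']
    exact mul_ne_zero (by linarith) hk0
  have he0 : e ≠ 0 := fun h0 => hew0 (by rw [h0, inner_zero_left])
  have he1 := one_le_norm_intLattice heL he0
  have hepos : 0 < ‖e‖ := by linarith
  refine ⟨e, w - (inner ℝ e w / ‖e‖ ^ 2) • e, heL, he0, heS, fun h => hew0 (hw e h), ?_,
    fun x hx => ?_, hen, ?_⟩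
  · rw [inner_sub_right, real_inner_smul_right, real_inner_self_eq_norm_sq,
      div_mul_cancel₀ _ (by positivity), sub_self]
  · have h1 := heS x hx
    rw [real_inner_comm] at h1
    rw [inner_sub_right, real_inner_smul_right, hw x hx, h1, mul_zero, sub_zero]
  · rw [sub_sub_cancel_left, norm_neg, norm_smul, Real.norm_eq_abs, abs_div, abs_pow, abs_norm,
      hew', abs_mul, abs_of_nonneg (by linarith : 0 ≤ Q)]
    have e1 : Q * |dot k w| / ‖e‖ ^ 2 * ‖e‖ = Q * |dot k w| / ‖e‖ := by field_simp
    rw [e1]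
    exact div_le_self (mul_nonneg (by linarith) (abs_nonneg _)) he1

theorem exists_gap_or_orthogonal (d j : ℕ) : ∃ A B : ℕ, ∀ X : ℝ, 16 ≤ X → d ≤ X →
    ∀ ρ₀ : ℝ, 0 < ρ₀ → ∀ p₀ : Momentum d,
    (∃ ρ w, ρ₀ ≤ ρ ∧ ρ ≤ X ^ B * ρ₀ ∧ ‖w - p₀‖ ≤ ρ / 8 ∧
      ∀ k : Fin d → ℤ, ‖k‖ ≤ X → dot k w = 0 ∨ X * ρ ≤ |dot k w|) ∨
    ∃ (S : Finset (Momentum d)) (w : Momentum d), S.card = j ∧ (∀ x ∈ S, x ∈ intLattice d) ∧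
      (∀ x ∈ S, x ≠ 0) ∧ (∀ x ∈ S, ∀ y ∈ S, x ≠ y → inner ℝ x y = 0) ∧
      (∀ x ∈ S, inner ℝ x w = 0) ∧ ∏ x ∈ S, ‖x‖ ^ 2 ≤ X ^ A ∧ ‖w - p₀‖ ≤ X ^ B * ρ₀ / 8 := by
  classical
  induction j with
  | zero =>
    refine ⟨0, 0, fun X _ _ ρ₀ hρ₀ p₀ => Or.inr ⟨∅, p₀, by simp, by simp, by simp, by simp, by simp,
      by simp, ?_⟩⟩
    rw [sub_self, norm_zero]
    positivity
  | succ j ih =>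
    obtain ⟨A, B, h⟩ := ih
    refine ⟨A + (2 * A + 4), B + (A + 2), fun X hX hdX ρ₀ hρ₀ p₀ => ?_⟩
    have hX0 : 0 < X := by linarith
    have hX1 : 1 ≤ X := by linarith
    have hBle : X ^ B * ρ₀ ≤ X ^ (B + (A + 2)) * ρ₀ := by
      refine mul_le_mul_of_nonneg_right (pow_le_pow_right₀ hX1 (by omega)) hρ₀.le
    rcases h X hX hdX ρ₀ hρ₀ p₀ with ⟨ρ, w, h1, h2, h3, h4⟩ | ⟨S, w, hcard, hS, hS0, horth, hw, hQ, hwp⟩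
    · exact Or.inl ⟨ρ, w, h1, h2.trans hBle, h3, h4⟩
    by_cases hgood : ∀ k : Fin d → ℤ, ‖k‖ ≤ X → dot k w = 0 ∨ X * (X ^ B * ρ₀) ≤ |dot k w|
    · refine Or.inl ⟨X ^ B * ρ₀, w, ?_, hBle, hwp, hgood⟩
      exact le_mul_of_one_le_left hρ₀.le (one_le_pow₀ hX1)
    right
    push Not at hgood
    obtain ⟨k, hkX, hk0, hklt⟩ := hgood
    have hQ1 : 1 ≤ ∏ x ∈ S, ‖x‖ ^ 2 := one_le_prod_norm_sq hS hS0
    obtain ⟨e, w', heL, he0, heS, heS', hew, hw', hen, hd⟩ :=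
      exists_resonance_step hS hS0 horth hw hk0
    have hk2 : ‖intVec k‖ ≤ X ^ 2 := by
      calc ‖intVec k‖ ≤ d * ‖k‖ := norm_intVec_le k
        _ ≤ X * X := mul_le_mul hdX hkX (norm_nonneg _) hX0.le
        _ = X ^ 2 := by ring
    have hen2 : ‖e‖ ≤ X ^ (A + 2) := by
      calc ‖e‖ ≤ (∏ x ∈ S, ‖x‖ ^ 2) * ‖intVec k‖ := hen
        _ ≤ X ^ A * X ^ 2 := mul_le_mul hQ hk2 (norm_nonneg _) (by positivity)
        _ = X ^ (A + 2) := by ring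
    refine ⟨insert e S, w', ?_, ?_, ?_, ?_, ?_, ?_, ?_⟩
    · rw [Finset.card_insert_of_notMem heS', hcard]
    · intro x hx
      rcases Finset.mem_insert.1 hx with rfl | hx
      · exact heL
      · exact hS x hx
    · intro x hx
      rcases Finset.mem_insert.1 hx with rfl | hx
      · exact he0
      · exact hS0 x hx
    · intro x hx y hy hxy
      rcases Finset.mem_insert.1 hx with hxe | hx' <;>
        rcases Finset.mem_insert.1 hy with hye | hy'
      · exact (hxy (hxe.trans hye.symm)).elim
      · rw [hxe]; exact heS y hy'
      · rw [hye, real_inner_comm]; exact heS x hx'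
      · exact horth x hx' y hy' hxy
    · intro x hx
      rcases Finset.mem_insert.1 hx with rfl | hx
      · exact hew
      · exact hw' x hx
    · rw [Finset.prod_insert heS']
      calc ‖e‖ ^ 2 * ∏ x ∈ S, ‖x‖ ^ 2 ≤ (X ^ (A + 2)) ^ 2 * X ^ A :=
            mul_le_mul (pow_le_pow_left₀ (norm_nonneg _) hen2 2) hQ (by linarith) (by positivity)
        _ = X ^ (A + (2 * A + 4)) := by ring
    · have hd' : ‖w' - w‖ ≤ X ^ A * (X * (X ^ B * ρ₀)) :=
        hd.trans (mul_le_mul hQ hklt.le (abs_nonneg _) (by positivity))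
      have htri : ‖w' - p₀‖ ≤ ‖w' - w‖ + ‖w - p₀‖ := by
        have := norm_add_le (w' - w) (w - p₀)
        rwa [sub_add_sub_cancel] at this
      have hpos : 0 < X ^ B * ρ₀ := by positivity
      have hA1 : 1 ≤ X ^ A * X := one_le_mul_of_one_le_of_one_le (one_le_pow₀ hX1) hX1
      have e2 : X ^ (B + (A + 2)) * ρ₀ / 8 = (X ^ A * X) * X * (X ^ B * ρ₀) / 8 := by ring
      have h1 : (X ^ A * X) * 16 * (X ^ B * ρ₀) ≤ (X ^ A * X) * X * (X ^ B * ρ₀) := by gcongr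
      have h2 : 1 * (X ^ B * ρ₀) ≤ X ^ A * X * (X ^ B * ρ₀) :=
        mul_le_mul_of_nonneg_right hA1 hpos.le
      have h3 : X ^ A * (X * (X ^ B * ρ₀)) = X ^ A * X * (X ^ B * ρ₀) := by ring
      rw [e2]
      linarith

/-- Every vector is close to a vector whose small divisors are either zero or large. -/
theorem exists_gap_approximation (d : ℕ) : ∃ B : ℕ, ∀ X : ℝ, 16 ≤ X → d ≤ X →
    ∀ ρ₀ : ℝ, 0 < ρ₀ → ∀ p₀ : Momentum d, ∃ ρ w, ρ₀ ≤ ρ ∧ ρ ≤ X ^ B * ρ₀ ∧ ‖w - p₀‖ ≤ ρ / 8 ∧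
      ∀ k : Fin d → ℤ, ‖k‖ ≤ X → dot k w = 0 ∨ X * ρ ≤ |dot k w| := by
  obtain ⟨A, B, h⟩ := exists_gap_or_orthogonal d (d + 1)
  refine ⟨B, fun X hX hdX ρ₀ hρ₀ p₀ => ?_⟩
  rcases h X hX hdX ρ₀ hρ₀ p₀ with h | ⟨S, w, hcard, -, hS0, horth, -⟩
  · exact h
  · have := card_le_of_orthogonal hS0 horth
    omega

end Resonances

section GlobalExistence

open Set Manifold

/-- Global existence for a globally Lipschitz vector field of class `C¹`. -/
theorem exists_global_solution {E : Type*} [NormedAddCommGroup E] [NormedSpace ℝ E]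
    [CompleteSpace E] {v : E → E} (hv : ContDiff ℝ 1 v) {K : NNReal} (hK : LipschitzWith K v)
    (x₀ : E) : ∃ γ : ℝ → E, γ 0 = x₀ ∧ ∀ t, HasDerivAt γ (v (γ t)) t := by
  have hτ : 0 < (1 + (K : ℝ))⁻¹ := by positivity
  have hloc : ∀ x : E, ∃ γ : ℝ → E, γ 0 = x ∧
      ∀ t ∈ Ioo (-(1 + (K : ℝ))⁻¹) (1 + (K : ℝ))⁻¹, HasDerivAt γ (v (γ t)) t := by
    intro x
    set a : NNReal := ‖v x‖₊ + 1 with ha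
    have hpl : IsPicardLindelof (fun _ => v) (tmin := -(1 + (K : ℝ))⁻¹) (tmax := (1 + (K : ℝ))⁻¹)
        ⟨0, by constructor <;> linarith⟩ x a 0 ((1 + K) * a) K := by
      refine IsPicardLindelof.of_time_independent (fun y hy => ?_) hK.lipschitzOnWith ?_
      · have h1 := hK.dist_le_mul y x
        rw [dist_eq_norm] at h1
        have h2 : dist y x ≤ a := hy
        have h3 : ‖v y‖ ≤ ‖v y - v x‖ + ‖v x‖ := by
          have := norm_add_le (v y - v x) (v x)
          rwa [sub_add_cancel] at this
        have h4 : ‖v x‖ ≤ a := by rw [ha]; push_cast; simp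
        have h5 : (K : ℝ) * dist y x ≤ K * a := mul_le_mul_of_nonneg_left h2 K.2
        push_cast
        linarith
      · push_cast
        simp only [sub_zero, zero_sub, neg_neg, max_self]
        have : (1 + (K : ℝ)) ≠ 0 := by positivity
        field_simp
        exact le_rfl
    obtain ⟨γ, h0, hγ⟩ := hpl.exists_eq_forall_mem_Icc_hasDerivWithinAt₀
    exact ⟨γ, h0, fun t ht => (hγ t (Ioo_subset_Icc_self ht)).hasDerivAt
      (Icc_mem_nhds ht.1 ht.2)⟩
  have hv' : ContMDiff 𝓘(ℝ, E) 𝓘(ℝ, E).tangent 1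
      (fun x => (⟨x, v x⟩ : TangentBundle 𝓘(ℝ, E) E)) := fun x =>
    contMDiffAt_vectorSpace_iff_contDiffAt.2 hv.contDiffAt
  obtain ⟨γ, h0, hγ⟩ := exists_isMIntegralCurve_of_isMIntegralCurveOn (I := 𝓘(ℝ, E)) (M := E)
    (v := v) hv' hτ (fun x => by
      obtain ⟨γ, h0, hγ⟩ := hloc x
      exact ⟨γ, h0, fun t ht => (hγ t ht).hasFDerivAt.hasMFDerivAt.hasMFDerivWithinAt⟩) x₀
  refine ⟨γ, h0, fun t => ?_⟩
  have h : HasFDerivAt γ ((1 : ℝ →L[ℝ] ℝ).smulRight (v (γ t))) t := (hγ t).hasFDerivAt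
  simpa using h.hasDerivAt

end GlobalExistence

section HamiltonianField

variable {V : Momentum d → Torus d → ℝ} {ε : ℝ}

theorem lift_hamiltonian (V : Momentum d → Torus d → ℝ) (ε : ℝ) (z : Phase d) :
    lift (hamiltonian V ε) z = ‖z.1‖ ^ 2 / 2 + ε * lift V z := by
  rw [EuclideanSpace.real_norm_sq_eq, Finset.sum_div]
  rfl

theorem hasFDerivAt_lift_hamiltonian (hV : IsSmooth V) (z : Phase d) :
    HasFDerivAt (lift (hamiltonian V ε)) ((innerSL ℝ z.1).comp
      (ContinuousLinearMap.fst ℝ _ _) + ε • fderiv ℝ (lift V) z) z := by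
  have e : lift (hamiltonian V ε) = fun z : Phase d => ‖z.1‖ ^ 2 / 2 + ε * lift V z :=
    funext fun z => lift_hamiltonian V ε z
  rw [e]
  have hVd : DifferentiableAt ℝ (lift V) z := (ContDiff.differentiable hV (by simp)) z
  have h1 : HasFDerivAt (fun z : Phase d => ‖z.1‖ ^ 2)
      (2 • (innerSL ℝ z.1).comp (ContinuousLinearMap.fst ℝ _ _)) z :=
    (hasFDerivAt_fst (p := z)).norm_sq
  have h2 := (h1.mul_const (1 / 2 : ℝ)).add (hVd.hasFDerivAt.const_mul ε)
  have e2 : (fun z : Phase d => ‖z.1‖ ^ 2 / 2 + ε * lift V z) =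
      (fun z : Phase d => ‖z.1‖ ^ 2 * (1 / 2)) + fun z => ε * lift V z := by
    ext z; simp [div_eq_mul_inv]
  rw [e2]
  refine h2.congr_fderiv (ContinuousLinearMap.ext fun y => ?_)
  simp

theorem partialP_hamiltonian (hV : IsSmooth V) (j : Fin d) (z : Phase d) :
    partialP (hamiltonian V ε) j z = z.1 j + ε * partialP V j z := by
  rw [partialP, (hasFDerivAt_lift_hamiltonian hV z).fderiv]
  simp [partialP, EuclideanSpace.inner_single_right]

theorem partialQ_hamiltonian (hV : IsSmooth V) (j : Fin d) (z : Phase d) :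
    partialQ (hamiltonian V ε) j z = ε * partialQ V j z := by
  rw [partialQ, (hasFDerivAt_lift_hamiltonian hV z).fderiv]
  simp [partialQ]

/-- The symplectic gradient, as a function of the differential. -/
def sympl : (Phase d →L[ℝ] ℝ) →L[ℝ] Phase d :=
  LinearMap.toContinuousLinearMap
    { toFun := fun L => (WithLp.toLp 2 fun j => -L (coordDir (Sum.inr j)),
        WithLp.toLp 2 fun j => L (coordDir (Sum.inl j)))
      map_add' := fun L M => by
        ext j <;> simp [add_comm]
      map_smul' := fun c L => by
        ext j <;> simp }

theorem sympl_fst (L : Phase d →L[ℝ] ℝ) (j : Fin d) :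
    (sympl L).1 j = -L (coordDir (Sum.inr j)) := rfl

theorem sympl_snd (L : Phase d →L[ℝ] ℝ) (j : Fin d) :
    (sympl L).2 j = L (coordDir (Sum.inl j)) := rfl

theorem toTorus_surjective : Function.Surjective (toTorus : EuclideanSpace ℝ (Fin d) → Torus d) := by
  intro q
  have : ∀ j, ∃ x : ℝ, (x : AddCircle (2 * Real.pi)) = q j := fun j =>
    QuotientAddGroup.mk_surjective (q j)
  choose x hx using this
  exact ⟨WithLp.toLp 2 x, funext hx⟩

theorem exists_solution (hV : IsSmooth V) (hVb : IsGloballyBounded V) (ε : ℝ) (p₀ : Momentum d)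
    (q₀ : Torus d) : ∃ (p : ℝ → Momentum d) (q : ℝ → Torus d),
      IsSolution (hamiltonian V ε) p q ∧ p 0 = p₀ ∧ q 0 = q₀ := by
  obtain ⟨x₀, rfl⟩ := toTorus_surjective q₀
  have hV' : ContDiff ℝ ∞ (lift V) := hV
  have hd : ContDiff ℝ ∞ (fderiv ℝ (lift V)) := hV'.fderiv_right (m := ∞) (by simp)
  obtain ⟨K, hK⟩ := hVb 2
  have hLip : LipschitzWith K.toNNReal (fderiv ℝ (lift V)) := by
    refine lipschitzWith_of_nnnorm_fderiv_le (𝕜 := ℝ) (hd.differentiable (by simp)) fun z => ?_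
    rw [← NNReal.coe_le_coe, coe_nnnorm, Real.coe_toNNReal']
    refine le_trans ?_ ((hK z).trans (le_max_left _ _))
    rw [← norm_iteratedFDeriv_fderiv, ← norm_iteratedFDeriv_fderiv, norm_iteratedFDeriv_zero]
  let S : Phase d →L[ℝ] Phase d :=
    (ContinuousLinearMap.inr ℝ (Momentum d) (EuclideanSpace ℝ (Fin d))).comp
      (ContinuousLinearMap.fst ℝ _ _)
  let v : Phase d → Phase d := fun z => S z + (ε • sympl) (fderiv ℝ (lift V) z)
  have hvC : ContDiff ℝ 1 v :=
    S.contDiff.add ((ε • sympl).contDiff.comp (hd.of_le (by exact_mod_cast le_top)))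
  have hvL := S.lipschitz.add ((ε • sympl (d := d)).lipschitz.comp hLip)
  obtain ⟨γ, h0, hγ⟩ := exists_global_solution hvC hvL (p₀, x₀)
  refine ⟨fun t => (γ t).1, fun t => toTorus (γ t).2, ⟨fun t => (γ t).2, fun _ => rfl,
    fun t j => ?_⟩, by simp [h0], by simp [h0]⟩
  rw [partialQ_hamiltonian hV, partialP_hamiltonian hV]
  have h1 : HasDerivAt (fun s => (γ s).1) (v (γ t)).1 t :=
    (ContinuousLinearMap.fst ℝ (Momentum d) (EuclideanSpace ℝ (Fin d))).hasFDerivAt.comp_hasDerivAt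
      t (hγ t)
  have h2 : HasDerivAt (fun s => (γ s).2) (v (γ t)).2 t :=
    (ContinuousLinearMap.snd ℝ (Momentum d) (EuclideanSpace ℝ (Fin d))).hasFDerivAt.comp_hasDerivAt
      t (hγ t)
  constructor
  · refine ((EuclideanSpace.proj (𝕜 := ℝ) j).hasFDerivAt.comp_hasDerivAt t h1).congr_deriv ?_
    change (0 : ℝ) + ε * -fderiv ℝ (lift V) (γ t) (coordDir (Sum.inr j)) = _
    simp [partialQ, coordDir]
  · refine ((EuclideanSpace.proj (𝕜 := ℝ) j).hasFDerivAt.comp_hasDerivAt t h2).congr_deriv ?_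
    change (γ t).1 j + ε * fderiv ℝ (lift V) (γ t) (coordDir (Sum.inl j)) = _
    simp [partialP, coordDir]

end HamiltonianField

section Rescaling

/-- Smooth functions, periodic in the angles, that are globally bounded with all derivatives. -/
structure Tame (g : Phase d → ℂ) : Prop where
  contDiff : ContDiff ℝ ∞ g
  periodic : ∀ p q n, g (p, q + period n) = g (p, q)
  bounded : ∀ n : ℕ, ∃ K : ℝ, ∀ z, ‖iteratedFDeriv ℝ n g z‖ ≤ K

theorem Tame.fderiv_apply {g : Phase d → ℂ} (hg : Tame g) (v : Phase d) :
    Tame fun z => fderiv ℝ g z v where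
  contDiff := (hg.contDiff.fderiv_right (m := ∞) (by simp)).clm_apply contDiff_const
  periodic p q n := by
    have e : (fun z : Phase d => g (z + (0, period n))) = g := by
      ext ⟨p, q⟩
      simpa using hg.periodic p q n
    have h := fderiv_comp_add_right (𝕜 := ℝ) (f := g) (x := (p, q)) (0, period n)
    rw [e] at h
    rw [h]
    simp
  bounded n := by
    obtain ⟨K, hK⟩ := hg.bounded (n + 1)
    refine ⟨‖v‖ * K, fun z => ?_⟩
    have h := norm_iteratedFDeriv_clm_apply_const (c := v) (n := n) (x := z)
      (hg.contDiff.fderiv_right (m := ∞) (by simp)).contDiffAt (by exact_mod_cast le_top)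
    rw [norm_iteratedFDeriv_fderiv] at h
    exact h.trans (mul_le_mul_of_nonneg_left (hK z) (norm_nonneg _))

theorem toTorus_add_period (q : EuclideanSpace ℝ (Fin d)) (n : Fin d → ℤ) :
    toTorus (q + period n) = toTorus q := by
  ext j
  change ((q j + 2 * Real.pi * n j : ℝ) : AddCircle (2 * Real.pi)) = ((q j : ℝ) : AddCircle _)
  rw [AddCircle.coe_add, mul_comm _ (n j : ℝ), ← zsmul_eq_mul, AddCircle.coe_zsmul, AddCircle.coe_period,
    smul_zero, add_zero]

theorem tame_ofReal_lift {V : Momentum d → Torus d → ℝ} (hV : IsSmooth V)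
    (hVb : IsGloballyBounded V) : Tame fun z : Phase d => ((lift V z : ℝ) : ℂ) where
  contDiff := Complex.ofRealCLM.contDiff.comp hV
  periodic p q n := by simp only [lift, toTorus_add_period]
  bounded n := by
    obtain ⟨K, hK⟩ := hVb n
    refine ⟨K, fun z => ?_⟩
    have h := Complex.ofRealLI.norm_iteratedFDeriv_comp_left (f := lift V) (x := z) (i := n)
      (ContDiff.contDiffAt hV) (by exact_mod_cast le_top)
    exact h.trans_le (hK z)

/-- A centre `w` in momentum space without resonances of order at most `X` other than exact ones,
together with the scale `ρ` around it and the relative size `η` of the perturbation. -/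
structure Param (d : ℕ) where
  X : ℝ
  ρ : ℝ
  η : ℝ
  w : Momentum d
  one_le_X : 1 ≤ X
  ρ_pos : 0 < ρ
  ρ_le_one : ρ ≤ 1
  η_nonneg : 0 ≤ η
  η_le_one : η ≤ 1
  gap : ∀ k : Fin d → ℤ, ‖k‖ ≤ X → dot k w = 0 ∨ X * ρ ≤ |dot k w|

/-- The affine change of variables `p = w + ρ P`. -/
def Param.chart (i : Param d) (z : Phase d) : Phase d := (i.w + i.ρ • z.1, z.2)

theorem Param.contDiff_chart (i : Param d) : ContDiff ℝ ∞ i.chart := by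
  unfold Param.chart
  fun_prop

theorem Param.hasFDerivAt_chart (i : Param d) (z : Phase d) : HasFDerivAt i.chart
    ((i.ρ • ContinuousLinearMap.fst ℝ (Momentum d) (EuclideanSpace ℝ (Fin d))).prod
      (ContinuousLinearMap.snd ℝ _ _)) z :=
  (((hasFDerivAt_fst (p := z)).const_smul i.ρ).const_add i.w).prodMk hasFDerivAt_snd

/-- The family of all rescalings of a function. -/
def rescale (g : Phase d → ℂ) (hg : Tame g) : families d (Param d) :=
  ⟨fun i z => g (i.chart z), fun i => ⟨hg.contDiff.comp i.contDiff_chart,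
    fun _ q n => hg.periodic _ q n⟩⟩

/-- The factor that a partial derivative picks up under rescaling. -/
def Param.factor (i : Param d) : Fin d ⊕ Fin d → ℝ
  | Sum.inl _ => i.ρ
  | Sum.inr _ => 1

theorem pd_rescale (a : Fin d ⊕ Fin d) {g : Phase d → ℂ} (hg : Tame g) :
    pd a (rescale g hg) = cst (fun i => ((i.factor a : ℝ) : ℂ)) *
      rescale _ (hg.fderiv_apply (coordDir a)) := by
  ext i z
  have hgd : HasFDerivAt g (fderiv ℝ g (i.chart z)) (i.chart z) :=
    (hg.contDiff.differentiable (by simp) _).hasFDerivAt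
  have h := (hgd.comp z (i.hasFDerivAt_chart z)).fderiv
  change fderiv ℝ (g ∘ i.chart) z (coordDir a) =
    (i.factor a : ℂ) * fderiv ℝ g (i.chart z) (coordDir a)
  rw [h, ← Complex.real_smul, ← map_smul, ContinuousLinearMap.comp_apply]
  congr 1
  cases a <;> simp [coordDir, Param.factor]

theorem rescale_mem_unifSmooth {g : Phase d → ℂ} (hg : Tame g) :
    rescale g hg ∈ unifSmooth d (Param d) := by
  rw [mem_unifSmooth]
  intro l
  induction l generalizing g with
  | nil =>
    obtain ⟨K, hK⟩ := hg.bounded 0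
    exact ⟨K, fun i z _ => (norm_iteratedFDeriv_zero (𝕜 := ℝ) (f := g)).symm.trans_le (hK (i.chart z))⟩
  | cons a l ih =>
    rw [iterPd_cons, pd_rescale, iterPd_cst_mul]
    refine UnifBdd.mul ⟨1, fun i z _ => ?_⟩ (ih (hg.fderiv_apply (coordDir a)))
    rw [cst_apply, Complex.norm_real, Real.norm_eq_abs, abs_le]
    have h0 := i.ρ_pos
    have h1 := i.ρ_le_one
    cases a <;> simp only [Param.factor] <;> constructor <;> linarith

theorem eq_sum_coordDir (u : Phase d) : u = ∑ j, (u.1 j • coordDir (Sum.inl j) +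
    u.2 j • coordDir (Sum.inr j)) := by
  ext k
  · simp [coordDir, Prod.fst_sum, Pi.single_apply]
  · simp [coordDir, Prod.snd_sum, Pi.single_apply]

/-- In the rescaled variables there is a function that is close to `∑ j, w_j P_j / (X ρ)` and
conserved up to `O(X ^ (-N))`. -/
theorem exists_approx_integral {V : Momentum d → Torus d → ℝ} (hV : IsSmooth V)
    (hVb : IsGloballyBounded V) (N : ℕ) : ∃ C : ℝ, 0 ≤ C ∧ ∀ i : Param d, ∃ G : Phase d → ℂ,
      Differentiable ℝ G ∧
      (∀ z : Phase d, ‖z.1‖ ≤ 1 →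
        ‖G z - ((∑ j, i.w j * z.1 j) / (i.X * i.ρ) : ℝ)‖ ≤ C * (i.η / i.X + (1 / i.X) ^ 2)) ∧
      ∀ z u : Phase d, ‖z.1‖ ≤ 1 →
        (∀ j, u.1 j = -(i.η / i.X * partialQ V j (i.chart z))) →
        (∀ j, u.2 j = i.w j / (i.X * i.ρ) +
          1 / i.X * (z.1 j + i.η * (i.ρ * partialP V j (i.chart z)))) →
        ‖fderiv ℝ G z u‖ ≤ C / i.X ^ N := by
  have hT := tame_ofReal_lift hV hVb
  let v : Param d → Momentum d := fun i => (1 / (i.X * i.ρ)) • i.w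
  have hdot : ∀ i k, dot k (v i) = dot k i.w / (i.X * i.ρ) := fun i k => by
    simp only [dot, v, PiLp.smul_apply, smul_eq_mul, Finset.sum_div]
    exact Finset.sum_congr rfl fun j _ => by ring
  have hXρ : ∀ i : Param d, 0 < i.X * i.ρ := fun i =>
    mul_pos (one_pos.trans_le i.one_le_X) i.ρ_pos
  obtain ⟨G, A, B, R, hA, hB, hR, hG, hGR⟩ := exists_approx_integral_family (X := Param.X)
    (η := Param.η) (v := v) Param.one_le_X Param.η_nonneg Param.η_le_one
    (fun i k hk => by
      rw [hdot, abs_div, abs_of_pos (hXρ i), one_le_div (hXρ i)]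
      exact (i.gap k hk).imp (fun h => by rw [h, zero_div]) id)
    (rescale_mem_unifSmooth hT) N
  obtain ⟨a, ha⟩ := unifSmooth.unifBdd hA
  obtain ⟨b, hb⟩ := unifSmooth.unifBdd hB
  obtain ⟨r, hr⟩ := unifSmooth.unifBdd hR
  refine ⟨max (max a b) (max r 0), by simp, fun i => ⟨G.1 i, families_differentiable G i,
    fun z hz => ?_, fun z u hz hu1 hu2 => ?_⟩⟩
  · have hX0 : 0 < i.X := one_pos.trans_le i.one_le_X
    have e : G.1 i z - ((∑ j, i.w j * z.1 j) / (i.X * i.ρ) : ℝ) =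
        ((i.η / i.X : ℝ) : ℂ) * A.1 i z + (((1 / i.X) ^ 2 : ℝ) : ℂ) * B.1 i z := by
      have : (linHam v).1 i z = (((∑ j, i.w j * z.1 j) / (i.X * i.ρ) : ℝ) : ℂ) := by
        rw [linHam, AddSubmonoidClass.coe_finsetSum, Finset.sum_apply, Finset.sum_apply,
          Finset.sum_div, Complex.ofReal_sum]
        refine Finset.sum_congr rfl fun j _ => ?_
        change ((v i j : ℝ) : ℂ) * ((z.1 j : ℝ) : ℂ) = _
        rw [← Complex.ofReal_mul]
        congr 1
        simp only [v, PiLp.smul_apply, smul_eq_mul]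
        ring
      rw [hG, ← this]
      change (linHam v).1 i z + ((i.η / i.X : ℝ) : ℂ) * A.1 i z +
        (((1 / i.X) ^ 2 : ℝ) : ℂ) * B.1 i z - (linHam v).1 i z = _
      ring
    rw [e]
    have h1 := i.η_nonneg
    refine (norm_add_le _ _).trans ?_
    rw [norm_mul, norm_mul, Complex.norm_real, Complex.norm_real,
      Real.norm_of_nonneg (by positivity), Real.norm_of_nonneg (by positivity), mul_add,
      mul_comm _ (i.η / i.X), mul_comm _ ((1 / i.X) ^ 2)]
    refine add_le_add (mul_le_mul_of_nonneg_left ((ha i z hz).trans ?_) (by positivity))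
      (mul_le_mul_of_nonneg_left ((hb i z hz).trans ?_) (by positivity))
    · exact (le_max_left _ _).trans (le_max_left _ _)
    · exact (le_max_right _ _).trans (le_max_left _ _)
  · have hX0 : 0 < i.X := one_pos.trans_le i.one_le_X
    have hVd : ∀ y (c : Phase d), fderiv ℝ (fun z : Phase d => ((lift V z : ℝ) : ℂ)) y c =
        ((fderiv ℝ (lift V) y c : ℝ) : ℂ) := fun y c => by
      have h : HasFDerivAt (lift V) (fderiv ℝ (lift V) y) y :=
        (ContDiff.differentiable hV (by simp) y).hasFDerivAt
      have h2 := (Complex.ofRealCLM.hasFDerivAt.comp y h).fderiv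
      change fderiv ℝ (Complex.ofRealCLM ∘ lift V) y c = _
      rw [h2]
      rfl
    have key : (poisson G (linHam v + cst (fun i => ((1 / i.X : ℝ) : ℂ)) *
        (kinetic + cst (fun i => (i.η : ℂ)) * rescale _ hT))).1 i z = fderiv ℝ (G.1 i) z u := by
      conv_rhs => rw [eq_sum_coordDir u, map_sum]
      rw [poisson_def, AddSubmonoidClass.coe_finsetSum, Finset.sum_apply, Finset.sum_apply]
      refine Finset.sum_congr rfl fun j _ => ?_
      simp only [map_add, pd_cst_mul, pd_inl_linHam, pd_inr_linHam, pd_inl_kinetic,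
        pd_inr_kinetic, pd_rescale, map_smul, hu1, hu2]
      change fderiv ℝ (G.1 i) z (coordDir (Sum.inr j)) * (((v i j : ℝ) : ℂ) +
          ((1 / i.X : ℝ) : ℂ) * (((z.1 j : ℝ) : ℂ) + (i.η : ℂ) * ((i.ρ : ℂ) *
            fderiv ℝ (fun z : Phase d => ((lift V z : ℝ) : ℂ)) (i.chart z)
              (coordDir (Sum.inl j))))) -
        fderiv ℝ (G.1 i) z (coordDir (Sum.inl j)) * (0 + ((1 / i.X : ℝ) : ℂ) * (0 + (i.η : ℂ) *
          (((1 : ℝ) : ℂ) * fderiv ℝ (fun z : Phase d => ((lift V z : ℝ) : ℂ)) (i.chart z)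
              (coordDir (Sum.inr j))))) = _
      simp only [hVd, Complex.real_smul, partialP, partialQ, coordDir, v, PiLp.smul_apply,
        smul_eq_mul]
      push_cast
      ring
    rw [← key, le_div_iff₀ (by positivity)]
    have h := hr i z hz
    rw [← hGR] at h
    change ‖(i.X : ℂ) ^ N * _‖ ≤ r at h
    rw [norm_mul, norm_pow, Complex.norm_real, Real.norm_of_nonneg hX0.le, mul_comm] at h
    exact h.trans ((le_max_left _ _).trans (le_max_right _ _))

end Rescaling

section Confinement

/-- A continuous function that is at most `1 / 2` as long as it has not exceeded `1` stays at most
`1 / 2`. -/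
theorem le_half_of_bootstrap {φ : ℝ → ℝ} (hφ : Continuous φ) {T : ℝ}
    (step : ∀ t ∈ Set.Icc 0 T, (∀ s ∈ Set.Icc 0 t, φ s ≤ 1) → φ t ≤ 1 / 2) (h0 : φ 0 ≤ 1 / 2) :
    ∀ t ∈ Set.Icc 0 T, φ t ≤ 1 / 2 := by
  intro t ht
  refine step t ht ?_
  by_contra! hcon
  obtain ⟨s, hs, hs1⟩ := hcon
  have hivt : ∀ r, 0 ≤ r → 1 < φ r → ∃ a ∈ Set.Icc 0 r, φ a = 1 := fun r hr h =>
    intermediate_value_Icc hr hφ.continuousOn ⟨by linarith, h.le⟩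
  have hne : (Set.Icc 0 s ∩ φ ⁻¹' {1}).Nonempty := by
    obtain ⟨a, ha, ha1⟩ := hivt s hs.1 hs1
    exact ⟨a, ha, ha1⟩
  have hcomp : IsCompact (Set.Icc 0 s ∩ φ ⁻¹' {1}) :=
    isCompact_Icc.inter_right (isClosed_singleton.preimage hφ)
  obtain ⟨a, ⟨ha, ha1⟩, hmin⟩ := hcomp.exists_isLeast hne
  have ha1' : φ a = 1 := ha1
  have := step a ⟨ha.1, (ha.2.trans hs.2).trans ht.2⟩ fun r hr => by
    by_contra! hr1
    obtain ⟨c, hc, hc1⟩ := hivt r hr.1 hr1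
    have h1 : a ≤ c := hmin ⟨⟨hc.1, (hc.2.trans hr.2).trans ha.2⟩, hc1⟩
    have h2 : c = r := le_antisymm hc.2 (hr.2.trans h1)
    rw [h2] at hc1
    linarith
  linarith

theorem hasDerivAt_phase {γ : ℝ → Phase d} {u : Phase d} {t : ℝ}
    (h1 : ∀ j, HasDerivAt (fun r => (γ r).1 j) (u.1 j) t)
    (h2 : ∀ j, HasDerivAt (fun r => (γ r).2 j) (u.2 j) t) : HasDerivAt γ u t := by
  let L : (Fin d → ℝ) →L[ℝ] EuclideanSpace ℝ (Fin d) := (EuclideanSpace.equiv (Fin d) ℝ).symm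
  have e1 := L.hasFDerivAt.comp_hasDerivAt t (hasDerivAt_pi.2 h1)
  have e2 := L.hasFDerivAt.comp_hasDerivAt t (hasDerivAt_pi.2 h2)
  exact e1.prodMk e2

theorem apply_sympl_self (L : Phase d →L[ℝ] ℝ) : L (sympl L) = 0 := by
  rw [eq_sum_coordDir (sympl L), map_sum]
  refine Finset.sum_eq_zero fun j _ => ?_
  rw [map_add, map_smul, map_smul, sympl_fst, sympl_snd, smul_eq_mul, smul_eq_mul]
  ring

variable {V : Momentum d → Torus d → ℝ}

/-- Conservation of energy. -/
theorem lift_hamiltonian_eq (hV : IsSmooth V) {ε s : ℝ} {γ : ℝ → Phase d}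
    (hγ : ∀ t, HasDerivAt γ (s • sympl (fderiv ℝ (lift (hamiltonian V ε)) (γ t))) t) (t : ℝ) :
    lift (hamiltonian V ε) (γ t) = lift (hamiltonian V ε) (γ 0) := by
  have h : ∀ t, HasDerivAt (fun r => lift (hamiltonian V ε) (γ r)) 0 t := fun t => by
    have hH := (hasFDerivAt_lift_hamiltonian (ε := ε) hV (γ t)).differentiableAt.hasFDerivAt
    refine (hH.comp_hasDerivAt t (hγ t)).congr_deriv ?_
    rw [map_smul, apply_sympl_self, smul_zero]
  exact is_const_of_deriv_eq_zero (fun t => (h t).differentiableAt) (fun t => (h t).deriv) t 0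

/-- The curve in the rescaled variables. -/
def Param.pull (i : Param d) (z : Phase d) : Phase d := (i.ρ⁻¹ • (z.1 - i.w), z.2)

theorem Param.chart_pull (i : Param d) (z : Phase d) : i.chart (i.pull z) = z := by
  have h := i.ρ_pos.ne'
  ext j <;> simp [Param.chart, Param.pull, h]

theorem Param.pull_fst_apply (i : Param d) (z : Phase d) (j : Fin d) :
    z.1 j = i.w j + i.ρ * (i.pull z).1 j := by
  conv_lhs => rw [← i.chart_pull z]
  rfl

theorem Param.hasDerivAt_pull (i : Param d) {γ : ℝ → Phase d} {u : Phase d} {t : ℝ}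
    (h : HasDerivAt γ u t) : HasDerivAt (fun r => i.pull (γ r)) (i.ρ⁻¹ • u.1, u.2) t := by
  have h1 : HasDerivAt (fun r => (γ r).1) u.1 t :=
    (ContinuousLinearMap.fst ℝ (Momentum d) (EuclideanSpace ℝ (Fin d))).hasFDerivAt.comp_hasDerivAt
      t h
  have h2 : HasDerivAt (fun r => (γ r).2) u.2 t :=
    (ContinuousLinearMap.snd ℝ (Momentum d) (EuclideanSpace ℝ (Fin d))).hasFDerivAt.comp_hasDerivAt
      t h
  exact ((h1.sub_const i.w).const_smul i.ρ⁻¹).prodMk h2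

/-- The energy in the rescaled variables. -/
theorem Param.lift_hamiltonian (i : Param d) (z : Phase d) :
    lift (hamiltonian V (i.η * i.ρ ^ 2)) z = ‖i.w‖ ^ 2 / 2 + i.ρ ^ 2 *
      (i.X * ((∑ j, i.w j * (i.pull z).1 j) / (i.X * i.ρ)) + ‖(i.pull z).1‖ ^ 2 / 2 +
        i.η * lift V z) := by
  have hρ := i.ρ_pos.ne'
  have hX : i.X ≠ 0 := (one_pos.trans_le i.one_le_X).ne'
  rw [SmoothNekhoroshev.lift_hamiltonian, EuclideanSpace.real_norm_sq_eq,
    EuclideanSpace.real_norm_sq_eq, EuclideanSpace.real_norm_sq_eq]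
  have e : ∑ j, z.1 j ^ 2 = ∑ j, i.w j ^ 2 + 2 * i.ρ * ∑ j, i.w j * (i.pull z).1 j +
      i.ρ ^ 2 * ∑ j, (i.pull z).1 j ^ 2 := by
    rw [Finset.mul_sum, Finset.mul_sum, ← Finset.sum_add_distrib, ← Finset.sum_add_distrib]
    refine Finset.sum_congr rfl fun j _ => ?_
    rw [i.pull_fst_apply z j]
    ring
  rw [e]
  field_simp
  ring

/-- Trajectories that start close to the centre of the parameters stay close for a long time. -/
theorem exists_confinement (hV : IsSmooth V) (hVb : IsGloballyBounded V) (N : ℕ) :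
    ∃ X₀ : ℝ, ∀ i : Param d, X₀ ≤ i.X → i.η * i.X ≤ 1 → ∀ (s : ℝ) (γ : ℝ → Phase d), |s| = 1 →
      (∀ t, HasDerivAt γ
        (s • sympl (fderiv ℝ (lift (hamiltonian V (i.η * i.ρ ^ 2))) (γ t))) t) →
      ‖(γ 0).1 - i.w‖ ≤ i.ρ / 8 → ∀ t ∈ Set.Icc 0 (i.X ^ N), ‖(γ t).1 - i.w‖ ≤ i.ρ / 2 := by
  obtain ⟨C, hC0, hC⟩ := exists_approx_integral hV hVb (N + 3)
  obtain ⟨K, hK⟩ := hVb 0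
  have hK' : ∀ z, |lift V z| ≤ K := fun z => by simpa using hK z
  refine ⟨16 * (5 * C + 2 * K), fun i hX hη s γ hs hγ h0 => ?_⟩
  obtain ⟨G, hGd, hG, hGvel⟩ := hC i
  have hX1 := i.one_le_X
  have hX0 : 0 < i.X := one_pos.trans_le hX1
  have hρ0 := i.ρ_pos
  have hρ1 := i.ρ_le_one
  have hη0 := i.η_nonneg
  have hnorm : ∀ t, ‖(i.pull (γ t)).1‖ = ‖(γ t).1 - i.w‖ / i.ρ := fun t => by
    change ‖i.ρ⁻¹ • ((γ t).1 - i.w)‖ = _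
    rw [norm_smul, norm_inv, Real.norm_of_nonneg hρ0.le, div_eq_inv_mul]
  have h0' : ‖(i.pull (γ 0)).1‖ ≤ 1 / 8 := by
    rw [hnorm, div_le_iff₀ hρ0]
    linarith
  have hpull : ∀ t, HasDerivAt (fun r => i.pull (γ r)) _ t := fun t => i.hasDerivAt_pull (hγ t)
  have hcont : Continuous fun t => ‖(i.pull (γ t)).1‖ :=
    ((continuous_iff_continuousAt.2 fun t => (hpull t).continuousAt).fst).norm
  suffices H : ∀ t ∈ Set.Icc 0 (i.X ^ N), ‖(i.pull (γ t)).1‖ ≤ 1 / 2 by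
    intro t ht
    have := H t ht
    rw [hnorm, div_le_iff₀ hρ0] at this
    linarith
  refine le_half_of_bootstrap hcont (fun t ht hle => ?_) (by linarith)
  have hdrift : ‖G (i.pull (γ t)) - G (i.pull (γ 0))‖ ≤ i.X * i.ρ * (C / i.X ^ (N + 3)) * (t - 0) := by
    refine norm_image_sub_le_of_norm_deriv_le_segment' (f := fun r => G (i.pull (γ r)))
      (fun r _ => ((hGd _).hasFDerivAt.comp_hasDerivAt r (hpull r)).hasDerivWithinAt)
      (fun r hr => ?_) t ⟨ht.1, le_rfl⟩
    set L := fderiv ℝ (lift (hamiltonian V (i.η * i.ρ ^ 2))) (γ r) with hL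
    let u : Phase d := (i.X * i.ρ)⁻¹ • (i.ρ⁻¹ • (sympl L).1, (sympl L).2)
    have hu : (i.ρ⁻¹ • (s • sympl L).1, (s • sympl L).2) = (s * (i.X * i.ρ)) • u := by
      ext j <;> simp [u] <;> field_simp
    have hb := hGvel (i.pull (γ r)) u (hle r ⟨hr.1, hr.2.le⟩) (fun j => by
        have e : L (coordDir (Sum.inr j)) = _ := partialQ_hamiltonian hV j (γ r)
        change (i.X * i.ρ)⁻¹ * (i.ρ⁻¹ * (sympl L).1 j) = _
        rw [sympl_fst, e, i.chart_pull]
        field_simp) (fun j => by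
        have e : L (coordDir (Sum.inl j)) = _ := partialP_hamiltonian hV j (γ r)
        change (i.X * i.ρ)⁻¹ * (sympl L).2 j = _
        rw [sympl_snd, e, i.chart_pull, i.pull_fst_apply (γ r) j]
        field_simp
        ring)
    rw [hu, map_smul, norm_smul, norm_mul, Real.norm_eq_abs, hs, one_mul,
      Real.norm_of_nonneg (by positivity)]
    exact mul_le_mul_of_nonneg_left hb (by positivity)
  have hsmall : i.X * (i.X * i.ρ * (C / i.X ^ (N + 3)) * (t - 0)) ≤ C / i.X := by
    have e : i.X * (i.X * 1 * (C / i.X ^ (N + 3)) * i.X ^ N) = C / i.X := by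
      field_simp
      ring
    rw [sub_zero, ← e]
    have := ht.1
    have := ht.2
    gcongr
  have henergy := lift_hamiltonian_eq hV hγ t
  rw [i.lift_hamiltonian, i.lift_hamiltonian] at henergy
  have hE := mul_left_cancel₀ (pow_ne_zero 2 hρ0.ne') (add_left_cancel henergy)
  set h1 := (∑ j, i.w j * (i.pull (γ t)).1 j) / (i.X * i.ρ) with hh1
  set h2 := (∑ j, i.w j * (i.pull (γ 0)).1 j) / (i.X * i.ρ) with hh2
  have hG1 := hG (i.pull (γ t)) (hle t ⟨ht.1, le_rfl⟩)
  have hG2 := hG (i.pull (γ 0)) (by linarith)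
  rw [← hh1] at hG1
  rw [← hh2] at hG2
  have hdiff : |h2 - h1| ≤ 2 * (C * (i.η / i.X + (1 / i.X) ^ 2)) +
      i.X * i.ρ * (C / i.X ^ (N + 3)) * (t - 0) := by
    have e : ((h2 - h1 : ℝ) : ℂ) = (G (i.pull (γ t)) - h1) - (G (i.pull (γ 0)) - h2) -
        (G (i.pull (γ t)) - G (i.pull (γ 0))) := by
      push_cast
      ring
    rw [← Real.norm_eq_abs, ← Complex.norm_real, e]
    refine (norm_sub_le _ _).trans (add_le_add ((norm_sub_le _ _).trans ?_) hdrift)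
    linarith
  have hηX : i.η ≤ 1 / i.X := by rwa [le_div_iff₀ hX0]
  have hXdiff : i.X * (h2 - h1) ≤ 5 * C / i.X := by
    have a1 := mul_le_mul_of_nonneg_left ((le_abs_self _).trans hdiff) hX0.le
    have a2 : i.X * (2 * (C * (i.η / i.X + (1 / i.X) ^ 2))) = 2 * C * (i.η + 1 / i.X) := by
      field_simp
    have a3 : 2 * C * (i.η + 1 / i.X) ≤ 2 * C * (1 / i.X + 1 / i.X) := by gcongr
    have a4 : 2 * C * (1 / i.X + 1 / i.X) + C / i.X = 5 * C / i.X := by ring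
    rw [mul_add] at a1
    linarith
  have hVdiff : i.η * (lift V (γ 0) - lift V (γ t)) ≤ 2 * K / i.X := by
    have b1 := (abs_le.1 (hK' (γ 0))).2
    have b2 := (abs_le.1 (hK' (γ t))).1
    have b3 : 0 ≤ K := (abs_nonneg _).trans (hK' (γ 0))
    calc i.η * (lift V (γ 0) - lift V (γ t)) ≤ i.η * (2 * K) :=
          mul_le_mul_of_nonneg_left (by linarith) hη0
      _ ≤ 1 / i.X * (2 * K) := mul_le_mul_of_nonneg_right hηX (by linarith)
      _ = 2 * K / i.X := by ring
  have hfin : 5 * C / i.X + 2 * K / i.X ≤ 1 / 16 := by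
    rw [← add_div, div_le_iff₀ hX0]
    linarith
  have hsq : ‖(i.pull (γ t)).1‖ ^ 2 ≤ (1 / 2) ^ 2 := by
    have c1 : ‖(i.pull (γ 0)).1‖ ^ 2 ≤ (1 / 8) ^ 2 := pow_le_pow_left₀ (norm_nonneg _) h0' 2
    nlinarith
  exact (pow_le_pow_iff_left₀ (norm_nonneg _) (by norm_num) two_ne_zero).1 hsq

end Confinement

section Stability

variable {V : Momentum d → Torus d → ℝ}

/-- Confinement, in both directions of time, for the solutions of Hamilton's equations. -/
theorem exists_solution_confinement (hV : IsSmooth V) (hVb : IsGloballyBounded V) (N : ℕ) :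
    ∃ X₀ : ℝ, ∀ i : Param d, X₀ ≤ i.X → i.η * i.X ≤ 1 → ∀ (p : ℝ → Momentum d) (q : ℝ → Torus d),
      IsSolution (hamiltonian V (i.η * i.ρ ^ 2)) p q → ‖p 0 - i.w‖ ≤ i.ρ / 8 →
      ∀ t, |t| ≤ i.X ^ N → ‖p t - p 0‖ ≤ i.ρ := by
  obtain ⟨X₀, h⟩ := exists_confinement hV hVb N
  refine ⟨X₀, fun i hX hη p q ⟨x, _, hsol⟩ h0 t ht => ?_⟩
  have hγ : ∀ t, HasDerivAt (fun r => ((p r, x r) : Phase d))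
      (sympl (fderiv ℝ (lift (hamiltonian V (i.η * i.ρ ^ 2))) (p t, x t))) t := fun t =>
    hasDerivAt_phase (fun j => (hsol t j).1) fun j => (hsol t j).2
  have hρ := i.ρ_pos
  suffices H : ‖p t - i.w‖ ≤ i.ρ / 2 by
    calc ‖p t - p 0‖ = ‖(p t - i.w) - (p 0 - i.w)‖ := by rw [sub_sub_sub_cancel_right]
      _ ≤ ‖p t - i.w‖ + ‖p 0 - i.w‖ := norm_sub_le _ _
      _ ≤ i.ρ := by linarith
  rcases le_total 0 t with h' | h'
  · rw [abs_of_nonneg h'] at ht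
    refine h i hX hη 1 (fun r => (p r, x r)) abs_one (fun r => ?_) h0 t ⟨h', ht⟩
    rw [one_smul]
    exact hγ r
  · rw [abs_of_nonpos h'] at ht
    have h1 : ∀ r, HasDerivAt (fun r => ((p (-r), x (-r)) : Phase d)) ((-1 : ℝ) •
        sympl (fderiv ℝ (lift (hamiltonian V (i.η * i.ρ ^ 2))) (p (-r), x (-r)))) r := fun r =>
      (hγ (-r)).scomp r (hasDerivAt_neg r)
    have h2 := h i hX hη (-1) _ (by rw [abs_neg, abs_one]) h1
    simp only [neg_zero] at h2
    have h3 := h2 h0 (-t) ⟨neg_nonneg.2 h', ht⟩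
    rwa [neg_neg] at h3

/-- The choice of the scales as powers of `ε`. -/
theorem exists_stability (hV : IsSmooth V) (hVb : IsGloballyBounded V) {b : ℝ} (hb0 : 0 < b)
    (hb : b < 1 / 2) (M : ℝ) : ∃ ε₀ : ℝ, 0 < ε₀ ∧ ∀ ε : ℝ, 0 < ε → ε < ε₀ →
      ∀ (p : ℝ → Momentum d) (q : ℝ → Torus d), IsSolution (hamiltonian V ε) p q →
      ∀ t : ℝ, |t| ≤ 1 / ε ^ M → ‖p t - p 0‖ ≤ ε ^ b := by
  obtain ⟨B, hB⟩ := exists_gap_approximation d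
  obtain ⟨δ, hδ, hδB⟩ : ∃ δ : ℝ, 0 < δ ∧ δ * (B + 1) = 1 / 2 - b :=
    ⟨(1 / 2 - b) / (B + 1), div_pos (by linarith) (by positivity), by field_simp⟩
  obtain ⟨X₀, hconf⟩ := exists_solution_confinement hV hVb ⌈M / δ⌉₊
  set X₁ : ℝ := max 16 (max d X₀) with hX₁
  have h16 : 16 ≤ X₁ := le_max_left _ _
  have hX₁0 : 0 < X₁ := by linarith
  refine ⟨X₁ ^ (-(1 / δ)), Real.rpow_pos_of_pos hX₁0 _, fun ε hε hεlt p q hsol t ht => ?_⟩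
  have hε1 : ε ≤ 1 := hεlt.le.trans
    (Real.rpow_le_one_of_one_le_of_nonpos (by linarith) (by simp [hδ.le]))
  set X : ℝ := ε ^ (-δ) with hX
  have hXX : X₁ ≤ X := by
    have h := Real.rpow_le_rpow_of_nonpos hε hεlt.le (neg_nonpos.2 hδ.le)
    rwa [← Real.rpow_mul hX₁0.le, neg_mul_neg, one_div, inv_mul_cancel₀ hδ.ne',
      Real.rpow_one] at h
  have hX16 : 16 ≤ X := h16.trans hXX
  have hX0 : 0 < X := by linarith
  obtain ⟨ρ, w, hρ₀, hρle, hw, hgap⟩ := hB X hX16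
    (((le_max_left _ _).trans (le_max_right _ _)).trans hXX) (X * ε ^ (1 / 2 : ℝ))
    (by positivity) (p 0)
  have hρ0 : 0 < ρ := lt_of_lt_of_le (by positivity) hρ₀
  have hρb : ρ ≤ ε ^ b := by
    refine hρle.trans_eq ?_
    rw [← mul_assoc, ← pow_succ, hX, ← Real.rpow_mul_natCast hε.le, ← Real.rpow_add hε]
    congr 1
    push_cast
    linarith
  have hρsq : ε * X ≤ ρ ^ 2 := by
    have h1 : (X * ε ^ (1 / 2 : ℝ)) ^ 2 ≤ ρ ^ 2 := pow_le_pow_left₀ (by positivity) hρ₀ 2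
    have h2 : (X * ε ^ (1 / 2 : ℝ)) ^ 2 = X * (ε * X) := by
      have h : (ε ^ (1 / 2 : ℝ)) ^ 2 = ε := by
        rw [← Real.rpow_mul_natCast hε.le]
        norm_num
      rw [mul_pow, h]
      ring
    have h3 : 1 * (ε * X) ≤ X * (ε * X) :=
      mul_le_mul_of_nonneg_right (by linarith) (by positivity)
    linarith
  have hηX : ε / ρ ^ 2 * X ≤ 1 := by
    rw [div_mul_eq_mul_div, div_le_one (by positivity)]
    exact hρsq
  have hη0 : 0 ≤ ε / ρ ^ 2 := by positivity
  let i : Param d :=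
    { X := X
      ρ := ρ
      η := ε / ρ ^ 2
      w := w
      one_le_X := by linarith
      ρ_pos := hρ0
      ρ_le_one := hρb.trans (Real.rpow_le_one hε.le hε1 hb0.le)
      η_nonneg := hη0
      η_le_one := le_trans (by nlinarith) hηX
      gap := hgap }
  have hεi : i.η * i.ρ ^ 2 = ε := div_mul_cancel₀ _ (pow_ne_zero 2 hρ0.ne')
  refine le_trans (hconf i (((le_max_right _ _).trans (le_max_right _ _)).trans hXX) hηX p q
    (by rwa [hεi]) (by rw [norm_sub_rev]; exact hw) t (ht.trans ?_)) hρb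
  have h1 : 1 / ε ^ M = X ^ (M / δ) := by
    rw [hX, ← Real.rpow_mul hε.le, one_div, ← Real.rpow_neg hε.le]
    congr 1
    field_simp
  rw [h1, ← Real.rpow_natCast]
  exact Real.rpow_le_rpow_of_exponent_le (by linarith) (Nat.le_ceil _)

end Stability

end SmoothNekhoroshev

end

theorem theorem1p1 (d : ℕ)
    (V : SmoothNekhoroshev.Momentum d → SmoothNekhoroshev.Torus d → ℝ)
    (hV : SmoothNekhoroshev.IsSmooth V) (hVb : SmoothNekhoroshev.IsGloballyBounded V)
    (b : ℝ) (hb0 : 0 < b) (hb : b < 1 / 2) (M : ℝ) (hM : 0 < M) :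
    ∃ C ε₀ : ℝ, 0 < C ∧ 0 < ε₀ ∧ ∀ ε : ℝ, 0 < ε → ε < ε₀ →
      ∀ (p₀ : SmoothNekhoroshev.Momentum d) (q₀ : SmoothNekhoroshev.Torus d),
        (∃ (p : ℝ → SmoothNekhoroshev.Momentum d) (q : ℝ → SmoothNekhoroshev.Torus d),
          SmoothNekhoroshev.IsSolution (SmoothNekhoroshev.hamiltonian V ε) p q ∧
            p 0 = p₀ ∧ q 0 = q₀) ∧
        ∀ (p : ℝ → SmoothNekhoroshev.Momentum d) (q : ℝ → SmoothNekhoroshev.Torus d),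
          SmoothNekhoroshev.IsSolution (SmoothNekhoroshev.hamiltonian V ε) p q →
          p 0 = p₀ → q 0 = q₀ →
          ∀ t : ℝ, |t| ≤ C / ε ^ M → ‖p t - p 0‖ ≤ C * ε ^ b := by
  obtain ⟨ε₀, hε₀, h⟩ := SmoothNekhoroshev.exists_stability hV hVb hb0 hb M
  refine ⟨1, ε₀, one_pos, hε₀, fun ε hε hlt p₀ q₀ =>
    ⟨SmoothNekhoroshev.exists_solution hV hVb ε p₀ q₀, fun p q hsol _ _ t ht => ?_⟩⟩
  rw [one_mul]
  exact h ε hε hlt p q hsol t ht
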